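/- Let $K$ be a field, $R=K[x_1,\dots,x_n]$ with a term order $<$, and let $F=(f_1,\dots,f_m)$ be a tuple of non-zero polynomials with $I=\langle F\rangle$; $F$ is a Gröbner basis if $\langle \mathrm{LM}(f): 0\neq f\in I\rangle=\langle \mathrm{LM}(F)\rangle$, where $\mathrm{LM}(F)=(\mathrm{LM}(f_1),\dots,\mathrm{LM}(f_m))$. Order the monomials of $R^m=\bigoplus_i Re_i$ by the Schreyer order: $x^\alpha e_i\prec x^\beta e_j$ iff $x^\alpha \mathrm{LM}(f_i)<x^\beta \mathrm{LM}(f_j)$, or these are equal and $i<j$. For $S\subseteq R^m$ let $\mathrm{LM}(S)$ be the set of leading monomials of the non-zero elements of $S$. Let $\mathrm{Syz}$ denote the module of syzygies of a tuple. A finite generating set $V$ of a submodule $M\subseteq R^m$ is a Gröbner basis of $M$ if $\langle \mathrm{LM}(V)\rangle=\langle \mathrm{LM}(M)\rangle$. A vector $\omega$ of $n$ positive integers is compatible with a set $A$ of monomials if for all $x^\alpha,x^\beta\in A$: $x^\alpha<x^\beta \iff \omega\cdot\alpha<\omega\cdot\beta$. For $f=\sum c_\alpha x^\alpha\neq 0$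 let $\deg_\omega f=\max\{\omega\cdot\alpha : c_\alpha\ne 0\}$ and $f^{(t)}=\sum c_\alpha t^{\deg_\omega f-\omega\cdot\alpha}x^\alpha\in R[t]$, and put $F^{(t)}_\omega=(f_1^{(t)},\dots,f_m^{(t)})$ and $X=\mathrm{Spec}\,R[t]/\langle F_\omega^{(t)}\rangle\subseteq \mathrm{Spec}\,R\times_K\mathbb A^1$, with its projection to $\mathbb A^1=\mathrm{Spec}\,K[t]$. Let $\varphi:\mathrm{Syz}(F_\omega^{(t)})\otimes_{K[t]}K[t]/\langle t\rangle\to R^m$ be given by $\varphi(w\otimes c)=c\,w|_{t=0}$. For $u\in R^m$, $\mathrm{LW}_\omega(u)$ is the sum of the terms of $u$ of maximal $\omega$-degree, where $\deg_\omega x^\alpha e_i=\omega\cdot\alpha+\deg_\omega f_i$. Put $$G(F)=\frac{\langle \mathrm{LM}(\mathrm{Syz}(\mathrm{LM}(F)))\rangle}{\langle \mathrm{LM}(\mathrm{Syz}(F))\rangle},\quad M(F)=\frac{\langle \mathrm{LM}(\mathrm{im}\,\varphi)\rangle}{\langle \mathrm{LM}(\mathrm{Syz}(F))\rangle},\quad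 N(F)=\frac{\langle \mathrm{LM}(\mathrm{Syz}(\mathrm{LM}(F)))\rangle}{\langle \mathrm{LM}(\mathrm{im}\,\varphi)\rangle}.$$ **Theorem.** (1) Let $\omega$ be compatible with the set of monomials appearing in the elements of $F$. Then: (a) for every field extension $L/K$ and every $0\neq a\in L$, the fibre of $X$ over the point $t=a$ is isomorphic over $L$ to $\mathrm{Spec}(R/I)\times_K \mathrm{Spec}\, L$ (hence to $\mathrm{Spec}\,R/I$ if $L=K$), and the fibre over $t=0$ is isomorphic over $K$ to $\mathrm{Spec}\,R/\langle\mathrm{LM}(F)\rangle$; (b) if all $f_i$ are monic, then $\varphi$ takes values in $\mathrm{Syz}(\mathrm{LM}(F))$; and always $\mathrm{LM}(\mathrm{im}\,\varphi)\subseteq\mathrm{LM}(\mathrm{Syz}(\mathrm{LM}(F)))$; (c) $F$ is a Gröbner basis if and only if $X$ is flat over $\mathbb A^1$ and $\mathrm{LM}(\mathrm{Syz}(F))=\mathrm{LM}(\mathrm{im}\,\varphi)$; (d) $X$ is flat over $\mathbb A^1$ if and only if $N(F)=0$. (2) Let moreover $V$ be a finite Gröbner basis of $\mathrm{Syz}(F)$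 and suppose that $\omega$ is compatible with the set consisting of the monomials appearing in the elements of $F$ and of the monomials $x^\alpha\mathrm{LM}(f_i)$ for which $x^\alpha e_i$ appears in an element of $V$. Then $\langle \mathrm{LW}_\omega(u) : u\in\mathrm{Syz}(F)\rangle=\mathrm{im}\,\varphi$ and $\mathrm{LM}(\mathrm{Syz}(F))\subseteq\mathrm{LM}(\mathrm{im}\,\varphi)$; the natural exact sequence $0\to M(F)\to G(F)\to N(F)\to 0$ of $R$-modules splits, so that $G(F)\cong M(F)\oplus N(F)$; and $F$ is a Gröbner basis if and only if $M(F)=N(F)=0$. (3) $\mathrm{Syz}(F)$ has a finite Gröbner basis, and for every such $V$ there is an $\omega$ as in (2). -/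

import Mathlib

universe u v

open MvPolynomial CategoryTheory CategoryTheory.Limits AlgebraicGeometry
open scoped TensorProduct

namespace GroebnerObstruction

noncomputable section

/-! ### Ideals and syzygies -/

/-- The ideal `I = ⟨f₁, …, f_m⟩` generated by a tuple. -/
def idealOf {A : Type u} [CommRing A] {m : ℕ} (F : Fin m → A) : Ideal A :=
  Ideal.span (Set.range F)

/-- The syzygy module of a tuple: the kernel of `A^m → A`, `u ↦ ∑ uᵢ fᵢ`. -/
def Syz {A : Type u} [CommRing A] {m : ℕ} (F : Fin m → A) : Submodule A (Fin m → A) :=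
  LinearMap.ker (Fintype.linearCombination A F)

variable {K : Type u} [Field K] {n m : ℕ}

/-- The tuple `LM(F)` of leading monomials. -/
def leadTuple (ord : MonomialOrder.{0, v} (Fin n)) (F : Fin m → MvPolynomial (Fin n) K) :
    Fin m → MvPolynomial (Fin n) K :=
  fun i => monomial (ord.degree (F i)) 1

/-- `F` is a Gröbner basis: the initial ideal of `I = ⟨F⟩`, that is, the ideal generated by all
`LM(f)` with `0 ≠ f ∈ I`, is generated by `LM(F)`. -/
def IsGroebner (ord : MonomialOrder.{0, v} (Fin n)) (F : Fin m → MvPolynomial (Fin n) K) : Prop :=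
  Ideal.span {g : MvPolynomial (Fin n) K |
      ∃ f ∈ idealOf F, f ≠ 0 ∧ g = monomial (ord.degree f) 1} =
    idealOf (leadTuple ord F)

/-! ### The Schreyer order on `R^m`; the pair `(α, i)` stands for the monomial `x^α eᵢ` -/

/-- The (strict) Schreyer order on the monomials `x^α eᵢ` of `R^m`. -/
def SchreyerLT (ord : MonomialOrder.{0, v} (Fin n)) (F : Fin m → MvPolynomial (Fin n) K)
    (s s' : (Fin n →₀ ℕ) × Fin m) : Prop :=
  ord.toSyn (s.1 + ord.degree (F s.2)) < ord.toSyn (s'.1 + ord.degree (F s'.2)) ∨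
    (s.1 + ord.degree (F s.2) = s'.1 + ord.degree (F s'.2) ∧ s.2 < s'.2)

/-- `s = LM(u)`: `s` is the largest monomial that occurs in `u` with non-zero coefficient. -/
def IsLeadMon (ord : MonomialOrder.{0, v} (Fin n)) (F : Fin m → MvPolynomial (Fin n) K)
    (u : Fin m → MvPolynomial (Fin n) K) (s : (Fin n →₀ ℕ) × Fin m) : Prop :=
  coeff s.1 (u s.2) ≠ 0 ∧
    ∀ s' : (Fin n →₀ ℕ) × Fin m, coeff s'.1 (u s'.2) ≠ 0 → s' ≠ s → SchreyerLT ord F s' s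

/-- `LM(S)`, the set of the leading monomials of the (non-zero) elements of `S ⊆ R^m`. -/
def LMset (ord : MonomialOrder.{0, v} (Fin n)) (F : Fin m → MvPolynomial (Fin n) K)
    (S : Set (Fin m → MvPolynomial (Fin n) K)) : Set ((Fin n →₀ ℕ) × Fin m) :=
  {s | ∃ u ∈ S, IsLeadMon ord F u s}

/-- The submodule of `R^m` generated by a set of monomials. -/
def monSpan (K : Type u) [Field K] {n m : ℕ} (T : Set ((Fin n →₀ ℕ) × Fin m)) :
    Submodule (MvPolynomial (Fin n) K) (Fin m → MvPolynomial (Fin n) K) :=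
  Submodule.span (MvPolynomial (Fin n) K)
    ((fun s : (Fin n →₀ ℕ) × Fin m => Pi.single s.2 (monomial s.1 (1 : K))) '' T)

/-- `V` is a (finite) Gröbner basis of the submodule `M` of `R^m` for the Schreyer order:
it generates `M`, and `LM(V)` generates the initial module of `M`. -/
def IsModuleGroebner (ord : MonomialOrder.{0, v} (Fin n)) (F : Fin m → MvPolynomial (Fin n) K)
    (V : Finset (Fin m → MvPolynomial (Fin n) K))
    (M : Submodule (MvPolynomial (Fin n) K) (Fin m → MvPolynomial (Fin n) K)) : Prop :=
  Submodule.span (MvPolynomial (Fin n) K) (V : Set (Fin m → MvPolynomial (Fin n) K)) = M ∧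
    monSpan K (LMset ord F (M : Set (Fin m → MvPolynomial (Fin n) K))) =
      monSpan K (LMset ord F (V : Set (Fin m → MvPolynomial (Fin n) K)))

/-! ### Weights -/

/-- `ω` is a vector of positive integers that is compatible with the set `A` of monomials. -/
def IsCompatible (ord : MonomialOrder.{0, v} (Fin n)) (ω : Fin n → ℕ) (A : Set (Fin n →₀ ℕ)) :
    Prop :=
  (∀ k, 0 < ω k) ∧ ∀ α ∈ A, ∀ β ∈ A,
    (ord.toSyn α < ord.toSyn β ↔ Finsupp.weight ω α < Finsupp.weight ω β)

/-- The monomials that appear in the elements of `F`. -/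
def monomialsOf (F : Fin m → MvPolynomial (Fin n) K) : Set (Fin n →₀ ℕ) :=
  {α | ∃ i, α ∈ (F i).support}

/-- The monomials `x^α LM(fᵢ)` for which `x^α eᵢ` appears in an element of `V`. -/
def shiftedMonomialsOf (ord : MonomialOrder.{0, v} (Fin n)) (F : Fin m → MvPolynomial (Fin n) K)
    (V : Finset (Fin m → MvPolynomial (Fin n) K)) : Set (Fin n →₀ ℕ) :=
  {β | ∃ w ∈ V, ∃ i, ∃ α ∈ (w i).support, β = α + ord.degree (F i)}

/-- The `ω`-degree of the monomial `x^α eᵢ`, namely `ω · α + deg_ω fᵢ`. -/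
def wdegMon (F : Fin m → MvPolynomial (Fin n) K) (ω : Fin n → ℕ) (α : Fin n →₀ ℕ) (i : Fin m) :
    ℕ :=
  Finsupp.weight ω α + weightedTotalDegree ω (F i)

/-- The `ω`-degree of `u ∈ R^m`: the maximum over the monomials that appear in `u`. -/
def wdeg (F : Fin m → MvPolynomial (Fin n) K) (ω : Fin n → ℕ)
    (u : Fin m → MvPolynomial (Fin n) K) : ℕ :=
  Finset.univ.sup fun i => (u i).support.sup fun α => wdegMon F ω α i

/-- The top terms `LW_ω(u)` of `u ∈ R^m`. -/
def topTerms (F : Fin m → MvPolynomial (Fin n) K) (ω : Fin n → ℕ)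
    (u : Fin m → MvPolynomial (Fin n) K) : Fin m → MvPolynomial (Fin n) K :=
  fun i => ∑ α ∈ (u i).support with wdegMon F ω α i = wdeg F ω u, monomial α (coeff α (u i))

/-! ### The homogenized family; `R[t]` is realised as `K[t][x₁, …, xₙ]` -/

/-- `f^(t) = ∑ c_α t^(deg_ω f - ω · α) x^α`. -/
def homogenize (ω : Fin n → ℕ) (f : MvPolynomial (Fin n) K) :
    MvPolynomial (Fin n) (Polynomial K) :=
  ∑ α ∈ f.support, monomial α
    (Polynomial.C (coeff α f) *
      Polynomial.X ^ (weightedTotalDegree ω f - Finsupp.weight ω α))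

/-- The tuple `F_ω^(t)`. -/
def homTuple (ω : Fin n → ℕ) (F : Fin m → MvPolynomial (Fin n) K) :
    Fin m → MvPolynomial (Fin n) (Polynomial K) :=
  fun i => homogenize ω (F i)

/-- The projection `Spec R[t]/J ⟶ Spec K[t] = 𝔸¹` of a closed subscheme of `Spec R ×_K 𝔸¹`. -/
def family (J : Ideal (MvPolynomial (Fin n) (Polynomial K))) :
    Spec (CommRingCat.of (MvPolynomial (Fin n) (Polynomial K) ⧸ J)) ⟶
      Spec (CommRingCat.of (Polynomial K)) :=
  Spec.map (CommRingCat.ofHom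
    (algebraMap (Polynomial K) (MvPolynomial (Fin n) (Polynomial K) ⧸ J)))

/-- The fibre of `family J` over the `L`-valued point `t = a` of `𝔸¹`, as a scheme over `L`. -/
def fiberAt (J : Ideal (MvPolynomial (Fin n) (Polynomial K))) (L : Type u) [Field L] [Algebra K L]
    (a : L) : Over (Spec (CommRingCat.of L)) :=
  Over.mk (pullback.snd (family J)
    (Spec.map (CommRingCat.ofHom (Polynomial.aeval (R := K) a).toRingHom)))

/-- The base change to `L` of `Spec R/I`, as a scheme over `L`. -/
def baseChangeSpec (I : Ideal (MvPolynomial (Fin n) K)) (L : Type u) [Field L] [Algebra K L] :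
    Over (Spec (CommRingCat.of L)) :=
  Over.mk (pullback.snd
    (Spec.map (CommRingCat.ofHom (algebraMap K (MvPolynomial (Fin n) K ⧸ I))))
    (Spec.map (CommRingCat.ofHom (algebraMap K L))))

/-- `Spec R/I` as a scheme over `K`. -/
def specOver (I : Ideal (MvPolynomial (Fin n) K)) : Over (Spec (CommRingCat.of K)) :=
  Over.mk (Spec.map (CommRingCat.ofHom (algebraMap K (MvPolynomial (Fin n) K ⧸ I))))

/-! ### The map `φ` -/

/-- The `K[t]`-module `K = K[t]/⟨t⟩`. -/
abbrev ResidueAtZero (K : Type u) [Field K] : Type u :=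
  Polynomial K ⧸ Ideal.span {(Polynomial.X : Polynomial K)}

/-- The identification `K[t]/⟨t⟩ → K`, `t ↦ 0`. -/
def residueToField (K : Type u) [Field K] : ResidueAtZero K →+* K :=
  Ideal.Quotient.lift _ Polynomial.constantCoeff (fun p hp => by
    obtain ⟨q, rfl⟩ := Ideal.mem_span_singleton.1 hp
    simp)

/-- The substitution `t ↦ 0` on `R[t]^m`. -/
def setTZero (K : Type u) [Field K] (n m : ℕ) :
    (Fin m → MvPolynomial (Fin n) (Polynomial K)) →+ (Fin m → MvPolynomial (Fin n) K) where
  toFun w := fun i => MvPolynomial.map Polynomial.constantCoeff (w i)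
  map_zero' := by ext1 i; simp
  map_add' a b := by ext1 i; simp

/-- The map `φ : Syz(F_ω^(t)) ⊗_{K[t]} K → R^m`, `eᵢ^(t) ↦ eᵢ`, `t ↦ 0`,
that is, `φ(w ⊗ c) = c · w|_{t = 0}`. -/
def phi (ω : Fin n → ℕ) (F : Fin m → MvPolynomial (Fin n) K) :
    (Syz (homTuple ω F)) ⊗[Polynomial K] (ResidueAtZero K) →+
      (Fin m → MvPolynomial (Fin n) K) :=
  TensorProduct.liftAddHom
    { toFun := fun w =>
        { toFun := fun c => residueToField K c • setTZero K n m w.1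
          map_zero' := by simp
          map_add' := fun a b => by simp [add_smul] }
      map_zero' := by ext1 c; simp
      map_add' := fun a b => by ext1 c; simp [smul_add] }
    (fun p w c => by
      obtain ⟨q, rfl⟩ := Ideal.Quotient.mk_surjective c
      have h1 : residueToField K (p • Ideal.Quotient.mk _ q) =
          Polynomial.constantCoeff p * Polynomial.constantCoeff q := by
        rw [← map_mul]; rfl
      have h2 : residueToField K (Ideal.Quotient.mk _ q) = Polynomial.constantCoeff q := rfl
      have h3 : setTZero K n m (p • w).1 = Polynomial.constantCoeff p • setTZero K n m w.1 := by
        ext1 i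
        simp [setTZero, MvPolynomial.smul_eq_C_mul]
      change residueToField K (Ideal.Quotient.mk _ q) • setTZero K n m (p • w).1 =
        residueToField K (p • Ideal.Quotient.mk _ q) • setTZero K n m w.1
      rw [h1, h2, h3, smul_smul, mul_comm])

/-! ### The sets of leading monomials and the modules `G(F)`, `M(F)`, `N(F)` -/

/-- `LM(Syz(F))`. -/
def LS (ord : MonomialOrder.{0, v} (Fin n)) (F : Fin m → MvPolynomial (Fin n) K) :
    Set ((Fin n →₀ ℕ) × Fin m) :=
  LMset ord F (Syz F : Set (Fin m → MvPolynomial (Fin n) K))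

/-- `LM(Syz(LM(F)))`. -/
def LSL (ord : MonomialOrder.{0, v} (Fin n)) (F : Fin m → MvPolynomial (Fin n) K) :
    Set ((Fin n →₀ ℕ) × Fin m) :=
  LMset ord F (Syz (leadTuple ord F) : Set (Fin m → MvPolynomial (Fin n) K))

/-- `LM(im φ)`. -/
def LImS (ord : MonomialOrder.{0, v} (Fin n)) (ω : Fin n → ℕ)
    (F : Fin m → MvPolynomial (Fin n) K) : Set ((Fin n →₀ ℕ) × Fin m) :=
  LMset ord F (Set.range (phi ω F))

/-- The quotient `⟨T⟩ / ⟨T'⟩` of submodules of `R^m` generated by sets `T' ⊆ T` of monomials. -/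
abbrev MonQuot (K : Type u) [Field K] {n m : ℕ} (T T' : Set ((Fin n →₀ ℕ) × Fin m)) : Type u :=
  monSpan K T ⧸ (monSpan K T').submoduleOf (monSpan K T)

/-- The class in `⟨T⟩ / ⟨T'⟩` of an element of `⟨T⟩`. -/
def MonQuot.mk {T : Set ((Fin n →₀ ℕ) × Fin m)} (T' : Set ((Fin n →₀ ℕ) × Fin m))
    (w : Fin m → MvPolynomial (Fin n) K) (hw : w ∈ monSpan K T) : MonQuot K T T' :=
  Submodule.Quotient.mk ⟨w, hw⟩

/-- The module of Gröbnerness obstructions `G(F) = ⟨LM(Syz(LM F))⟩ / ⟨LM(Syz F)⟩`. -/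
abbrev ObstructionModule (ord : MonomialOrder.{0, v} (Fin n))
    (F : Fin m → MvPolynomial (Fin n) K) : Type u :=
  MonQuot K (LSL ord F) (LS ord F)

/-- `M(F) = ⟨LM(im φ)⟩ / ⟨LM(Syz F)⟩`. -/
abbrev MPart (ord : MonomialOrder.{0, v} (Fin n)) (ω : Fin n → ℕ)
    (F : Fin m → MvPolynomial (Fin n) K) : Type u :=
  MonQuot K (LImS ord ω F) (LS ord F)

/-- `N(F) = ⟨LM(Syz(LM F))⟩ / ⟨LM(im φ)⟩`. -/
abbrev NPart (ord : MonomialOrder.{0, v} (Fin n)) (ω : Fin n → ℕ)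
    (F : Fin m → MvPolynomial (Fin n) K) : Type u :=
  MonQuot K (LSL ord F) (LImS ord ω F)

end

end GroebnerObstruction

open GroebnerObstruction

/-! Everything reduces to comparing the sets of leading monomials of three modules: Syz(F), im φ and
Syz(LM(F)). The tuple of leading terms `initTuple`, which is F^(t) at t = 0, may replace LM(F),
since its syzygies have the same leading monomials (`LSL_eq`).

Gröbner side: F is a Gröbner basis iff LM(Syz(LM(F))) ⊆ LM(Syz(F)). Given the inclusion, a
representation ∑ uᵢfᵢ whose top multidegree cancels is improved by subtracting a syzygy of F with
the same leading monomial. Conversely, division by a Gröbner basis lifts a syzygy of the leading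
terms to one of F, and the lift can be kept within the same ω-degree (`IsGroebner.exists_syzygy`).

Family side: x_k ↦ t^(ω_k) x_k turns f^(t) into t^(deg f) f. Hence syzygies of F homogenize to
syzygies of F^(t), t-coefficients lead back, and im φ is generated by top ω-forms of syzygies. Over
K[t], flat means torsion-free. The family is trivial away from t = 0, so only t-torsion matters, and
its absence means that every syzygy of the special fibre lifts: Syz(`initTuple`) ⊆ im φ
(`flat_family_iff_le_imPhi`). The opposite inclusion always holds, so leading monomials decide, and
flatness becomes N(F) = 0.

In part (2), LM(Syz(F)) = LM(im φ), so M(F) = 0 and the splitting is immediate. Top forms of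
elements of V keep their leading monomials, which gives one inclusion. For the other, leading
monomials of im φ are leading monomials of Syz(F) for the order that compares ω-degrees first; V
shows that the Schreyer initial module lies in that one, and nested initial modules of the same
module are equal (`exists_isLead_of_isLead`).

Compatible weights come from Fourier–Motzkin elimination, the fibres from base change and a scaling
automorphism. -/

namespace GroebnerObstruction

noncomputable section

/-! ### Monomials of the free module -/

section FreeModule

variable {K : Type u} [Field K] {n m : ℕ}

/-- The term `c x^α eᵢ` for `s = (α, i)`. -/
def term (s : (Fin n →₀ ℕ) × Fin m) (c : K) : Fin m → MvPolynomial (Fin n) K :=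
  Pi.single s.2 (monomial s.1 c)

theorem coeff_term (s p : (Fin n →₀ ℕ) × Fin m) (c : K) :
    coeff p.1 (term s c p.2) = if s = p then c else 0 := by
  obtain ⟨a, i⟩ := s
  obtain ⟨b, j⟩ := p
  by_cases h : i = j
  · subst h
    simp [term, coeff_monomial]
  · simp [term, h]

theorem free_ext {u w : Fin m → MvPolynomial (Fin n) K}
    (h : ∀ s : (Fin n →₀ ℕ) × Fin m, coeff s.1 (u s.2) = coeff s.1 (w s.2)) : u = w := by
  ext i a
  exact h (a, i)

/-- The monomials that occur in an element of the free module. -/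
def freeSupport (u : Fin m → MvPolynomial (Fin n) K) : Finset ((Fin n →₀ ℕ) × Fin m) :=
  Finset.univ.biUnion fun i => (u i).support ×ˢ {i}

theorem mem_freeSupport {u : Fin m → MvPolynomial (Fin n) K} {s : (Fin n →₀ ℕ) × Fin m} :
    s ∈ freeSupport u ↔ coeff s.1 (u s.2) ≠ 0 := by
  obtain ⟨a, i⟩ := s
  simp [freeSupport]

theorem sum_term (u : Fin m → MvPolynomial (Fin n) K) :
    ∑ s ∈ freeSupport u, term s (coeff s.1 (u s.2)) = u := by
  refine free_ext fun p => ?_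
  rw [Finset.sum_apply, coeff_sum]
  simp only [coeff_term]
  rw [Finset.sum_ite_eq']
  split_ifs with h
  · rfl
  · rw [mem_freeSupport, not_not] at h
    exact h.symm

theorem monomial_smul_term (s : (Fin n →₀ ℕ) × Fin m) (δ : Fin n →₀ ℕ) (c d : K) :
    (monomial δ c : MvPolynomial (Fin n) K) • term s d = term (s.1 + δ, s.2) (c * d) := by
  rw [term, term, ← Pi.single_smul, smul_eq_mul, monomial_mul, add_comm]

theorem coeff_monomial_smul (u : Fin m → MvPolynomial (Fin n) K) (s : (Fin n →₀ ℕ) × Fin m)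
    (δ : Fin n →₀ ℕ) (c : K) :
    coeff (s.1 + δ) (((monomial δ c : MvPolynomial (Fin n) K) • u) s.2) =
      c * coeff s.1 (u s.2) := by
  rw [Pi.smul_apply, smul_eq_mul, add_comm, coeff_monomial_mul]

theorem exists_of_coeff_monomial_smul {u : Fin m → MvPolynomial (Fin n) K}
    {p : (Fin n →₀ ℕ) × Fin m} {δ : Fin n →₀ ℕ} {c : K}
    (h : coeff p.1 (((monomial δ c : MvPolynomial (Fin n) K) • u) p.2) ≠ 0) :
    ∃ s : (Fin n →₀ ℕ) × Fin m, p = (s.1 + δ, s.2) ∧ coeff s.1 (u s.2) ≠ 0 := by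
  rw [Pi.smul_apply, smul_eq_mul, coeff_monomial_mul'] at h
  split_ifs at h with hle
  · exact ⟨(p.1 - δ, p.2), by simp [tsub_add_cancel_of_le hle], right_ne_zero_of_mul h⟩
  · exact absurd rfl h

theorem coeff_C_smul (u : Fin m → MvPolynomial (Fin n) K) (s : (Fin n →₀ ℕ) × Fin m) (c : K) :
    coeff s.1 (((C c : MvPolynomial (Fin n) K) • u) s.2) = c * coeff s.1 (u s.2) := by
  rw [Pi.smul_apply, smul_eq_mul, coeff_C_mul]

/-- Membership in a monomial submodule is tested term by term, so quotients of such modules are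
governed by sets of monomials. -/
theorem mem_monSpan {T : Set ((Fin n →₀ ℕ) × Fin m)} {u : Fin m → MvPolynomial (Fin n) K} :
    u ∈ monSpan K T ↔
      ∀ s : (Fin n →₀ ℕ) × Fin m, coeff s.1 (u s.2) ≠ 0 → ∃ t ∈ T, ∃ δ, s = (t.1 + δ, t.2) := by
  constructor
  · intro hu
    induction hu using Submodule.span_induction with
    | mem x hx =>
      obtain ⟨t, ht, rfl⟩ := hx
      intro s hs
      have := coeff_term t s (1 : K)
      rw [term] at this
      simp only [this] at hs
      have h : t = s := by by_contra h; simp [h] at hs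
      exact ⟨t, ht, 0, by simp [h]⟩
    | zero => intro s hs; simp at hs
    | add x y _ _ hx hy =>
      intro s hs
      by_cases h : coeff s.1 (x s.2) = 0
      · exact hy s (by simpa [h] using hs)
      · exact hx s h
    | smul r x _ hx =>
      intro s hs
      rw [Pi.smul_apply, smul_eq_mul, coeff_mul] at hs
      obtain ⟨⟨a, b⟩, hab, h⟩ := Finset.exists_ne_zero_of_sum_ne_zero hs
      obtain ⟨t, ht, δ, h'⟩ := hx (b, s.2) (right_ne_zero_of_mul h)
      rw [Finset.HasAntidiagonal.mem_antidiagonal] at hab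
      rw [Prod.ext_iff] at h'
      refine ⟨t, ht, δ + a, Prod.ext ?_ h'.2⟩
      simp only at h' hab ⊢
      rw [← hab, h'.1]
      abel
  · intro h
    rw [← sum_term u]
    refine Submodule.sum_mem _ fun s hs => ?_
    obtain ⟨t, ht, δ, h'⟩ := h s (mem_freeSupport.1 hs)
    have : term s (coeff s.1 (u s.2)) =
        (monomial δ (coeff s.1 (u s.2)) : MvPolynomial (Fin n) K) • term t 1 := by
      rw [monomial_smul_term, mul_one, ← h']
    rw [this]
    exact Submodule.smul_mem _ _ (Submodule.subset_span ⟨t, ht, rfl⟩)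

theorem term_mem_monSpan {T : Set ((Fin n →₀ ℕ) × Fin m)} {s : (Fin n →₀ ℕ) × Fin m}
    (hs : s ∈ T) : term s (1 : K) ∈ monSpan K T :=
  Submodule.subset_span ⟨s, hs, rfl⟩

theorem exists_of_term_mem_monSpan {T : Set ((Fin n →₀ ℕ) × Fin m)} {s : (Fin n →₀ ℕ) × Fin m}
    (hs : term s (1 : K) ∈ monSpan K T) : ∃ t ∈ T, ∃ δ, s = (t.1 + δ, t.2) :=
  mem_monSpan.1 hs s (by simp [coeff_term])

theorem monSpan_mono {T T' : Set ((Fin n →₀ ℕ) × Fin m)} (h : T ⊆ T') :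
    monSpan K T ≤ monSpan K T' :=
  Submodule.span_mono (Set.image_mono h)

/-- A set of monomials that is closed under multiplication by monomials of `R`. -/
def IsMonomialClosed (T : Set ((Fin n →₀ ℕ) × Fin m)) : Prop :=
  ∀ s ∈ T, ∀ δ, (s.1 + δ, s.2) ∈ T

theorem subset_of_monSpan_le {T T' : Set ((Fin n →₀ ℕ) × Fin m)} (hT' : IsMonomialClosed T')
    (h : monSpan K T ≤ monSpan K T') : T ⊆ T' := by
  intro s hs
  obtain ⟨t, ht, δ, rfl⟩ := exists_of_term_mem_monSpan (h (term_mem_monSpan (K := K) hs))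
  exact hT' t ht δ

theorem subsingleton_monQuot_iff {T T' : Set ((Fin n →₀ ℕ) × Fin m)} (hT' : IsMonomialClosed T') :
    Subsingleton (MonQuot K T T') ↔ T ⊆ T' := by
  rw [Submodule.Quotient.subsingleton_iff, Submodule.submoduleOf_eq_top]
  exact ⟨subset_of_monSpan_le hT', monSpan_mono⟩

end FreeModule

/-! ### Leading monomials with respect to a key -/

section Lead

variable {K : Type u} [Field K] {n m : ℕ} {Γ : Type*} [LinearOrder Γ]

/-- An injective map to a linear order that is strictly monotone under multiplication by
monomials; it encodes a term order on the free module. -/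
structure IsTermKey (key : (Fin n →₀ ℕ) × Fin m → Γ) : Prop where
  injective : Function.Injective key
  shift : ∀ s s' : (Fin n →₀ ℕ) × Fin m, ∀ δ, key s < key s' →
    key (s.1 + δ, s.2) < key (s'.1 + δ, s'.2)

/-- `s` is the leading monomial of `u` for the order given by `key`. -/
def IsLead (key : (Fin n →₀ ℕ) × Fin m → Γ) (u : Fin m → MvPolynomial (Fin n) K)
    (s : (Fin n →₀ ℕ) × Fin m) : Prop :=
  coeff s.1 (u s.2) ≠ 0 ∧
    ∀ s' : (Fin n →₀ ℕ) × Fin m, coeff s'.1 (u s'.2) ≠ 0 → s' ≠ s → key s' < key s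

variable {key : (Fin n →₀ ℕ) × Fin m → Γ}

theorem IsLead.le {u : Fin m → MvPolynomial (Fin n) K} {s s' : (Fin n →₀ ℕ) × Fin m}
    (h : IsLead key u s) (hs' : coeff s'.1 (u s'.2) ≠ 0) : key s' ≤ key s := by
  by_cases h' : s' = s
  · rw [h']
  · exact (h.2 s' hs' h').le

theorem IsLead.ne_zero {u : Fin m → MvPolynomial (Fin n) K} {s : (Fin n →₀ ℕ) × Fin m}
    (h : IsLead key u s) : u ≠ 0 := by
  rintro rfl
  exact h.1 (by simp)

theorem exists_coeff_ne_zero {u : Fin m → MvPolynomial (Fin n) K} (hu : u ≠ 0) :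
    ∃ s : (Fin n →₀ ℕ) × Fin m, coeff s.1 (u s.2) ≠ 0 := by
  by_contra! h
  exact hu (free_ext fun s => by simpa using h s)

theorem exists_isLead (hkey : IsTermKey key) {u : Fin m → MvPolynomial (Fin n) K} (hu : u ≠ 0) :
    ∃ s, IsLead key u s := by
  obtain ⟨s₀, h₀⟩ := exists_coeff_ne_zero hu
  obtain ⟨s, hs, hmax⟩ := (freeSupport u).exists_max_image key ⟨s₀, mem_freeSupport.2 h₀⟩
  exact ⟨s, mem_freeSupport.1 hs, fun s' h' hne =>
    (hmax s' (mem_freeSupport.2 h')).lt_of_ne fun h => hne (hkey.injective h)⟩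

theorem IsLead.monomial_smul (hkey : IsTermKey key) {u : Fin m → MvPolynomial (Fin n) K}
    {s : (Fin n →₀ ℕ) × Fin m} (h : IsLead key u s) (δ : Fin n →₀ ℕ) {c : K} (hc : c ≠ 0) :
    IsLead key ((monomial δ c : MvPolynomial (Fin n) K) • u) (s.1 + δ, s.2) := by
  refine ⟨?_, fun p hp hne => ?_⟩
  · rw [coeff_monomial_smul]
    exact mul_ne_zero hc h.1
  · obtain ⟨s', rfl, hs'⟩ := exists_of_coeff_monomial_smul hp
    exact hkey.shift _ _ _ (h.2 s' hs' (by rintro rfl; exact hne rfl))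

/-- One reduction step: the quotient of the leading coefficients cancels `s`, and every other
monomial of `u` or `w` is already smaller. The descents on leading monomials rest on it. -/
theorem key_lt_of_coeff_sub {u w : Fin m → MvPolynomial (Fin n) K}
    {s s' : (Fin n →₀ ℕ) × Fin m} (hu : IsLead key u s) (hw : IsLead key w s)
    (hs' : coeff s'.1 ((u - (C (coeff s.1 (u s.2) / coeff s.1 (w s.2)) :
      MvPolynomial (Fin n) K) • w) s'.2) ≠ 0) : key s' < key s := by
  rw [Pi.sub_apply, coeff_sub, coeff_C_smul] at hs'
  by_cases h : s' = s
  · subst h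
    rw [div_mul_cancel₀ _ hw.1, sub_self] at hs'
    exact absurd rfl hs'
  · by_cases h' : coeff s'.1 (u s'.2) = 0
    · exact hw.2 s' (fun h0 => hs' (by simp [h0, h'])) h
    · exact hu.2 s' h' h

/-- Well-founded descent: subtracting a multiple of an element of `N` with the same leading monomial
stays inside `N'` and lowers the leading monomial. -/
theorem le_of_leads_subset [WellFoundedLT Γ] (hkey : IsTermKey key)
    {N N' : Submodule (MvPolynomial (Fin n) K) (Fin m → MvPolynomial (Fin n) K)} (hN : N ≤ N')
    (h : ∀ u ∈ N', ∀ s, IsLead key u s → ∃ w ∈ N, IsLead key w s) : N' ≤ N := by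
  have main : ∀ g : Γ, ∀ u ∈ N', ∀ s, IsLead key u s → key s = g → u ∈ N := by
    intro g
    induction g using WellFoundedLT.induction with
    | ind g ih =>
      intro u hu s hs hg
      obtain ⟨w, hw, hws⟩ := h u hu s hs
      have hmem : (C (coeff s.1 (u s.2) / coeff s.1 (w s.2)) : MvPolynomial (Fin n) K) • w ∈ N :=
        N.smul_mem _ hw
      have : u - (C (coeff s.1 (u s.2) / coeff s.1 (w s.2)) : MvPolynomial (Fin n) K) • w ∈ N := by
        by_cases h0 : u - (C (coeff s.1 (u s.2) / coeff s.1 (w s.2)) :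
            MvPolynomial (Fin n) K) • w = 0
        · rw [h0]; exact N.zero_mem
        · obtain ⟨s', hs'⟩ := exists_isLead hkey h0
          exact ih _ (hg ▸ key_lt_of_coeff_sub hs hws hs'.1) _ (N'.sub_mem hu (hN hmem)) s' hs' rfl
      simpa using N.add_mem this hmem
  intro u hu
  by_cases h0 : u = 0
  · rw [h0]; exact N.zero_mem
  · obtain ⟨s, hs⟩ := exists_isLead hkey h0
    exact main _ u hu s hs rfl

end Lead

/-! ### The Schreyer order -/

section Schreyer

variable {K : Type u} [Field K] {n m : ℕ} (ord : MonomialOrder.{0, v} (Fin n))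
  (F : Fin m → MvPolynomial (Fin n) K)

/-- The key of the Schreyer order. -/
def schreyerKey (s : (Fin n →₀ ℕ) × Fin m) : ord.syn ×ₗ Fin m :=
  toLex (ord.toSyn (s.1 + ord.degree (F s.2)), s.2)

theorem schreyerKey_lt_iff {s s' : (Fin n →₀ ℕ) × Fin m} :
    schreyerKey ord F s < schreyerKey ord F s' ↔ SchreyerLT ord F s s' := by
  rw [schreyerKey, schreyerKey, Prod.Lex.toLex_lt_toLex, SchreyerLT, ord.toSyn.injective.eq_iff]

theorem isTermKey_schreyerKey : IsTermKey (schreyerKey ord F) where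
  injective := by
    rintro ⟨a, i⟩ ⟨b, j⟩ h
    have h := toLex.injective h
    rw [Prod.mk.injEq] at h
    obtain ⟨h1, rfl⟩ := h
    rw [ord.toSyn.injective.eq_iff, add_left_inj] at h1
    exact Prod.ext h1 rfl
  shift := by
    intro s s' δ h
    rw [schreyerKey_lt_iff] at h ⊢
    unfold SchreyerLT at h ⊢
    simp only [add_right_comm _ δ, add_left_inj]
    rcases h with h | h
    · left
      rw [map_add _ _ δ, map_add _ _ δ]
      exact add_lt_add_left h _
    · exact Or.inr h

theorem isLeadMon_iff {u : Fin m → MvPolynomial (Fin n) K} {s : (Fin n →₀ ℕ) × Fin m} :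
    IsLeadMon ord F u s ↔ IsLead (schreyerKey ord F) u s := by
  simp only [IsLeadMon, IsLead, schreyerKey_lt_iff]

theorem mem_LMset {S : Set (Fin m → MvPolynomial (Fin n) K)} {s : (Fin n →₀ ℕ) × Fin m} :
    s ∈ LMset ord F S ↔ ∃ u ∈ S, IsLead (schreyerKey ord F) u s := by
  simp only [LMset, isLeadMon_iff, Set.mem_ofPred_eq]

theorem isMonomialClosed_LMset
    (N : Submodule (MvPolynomial (Fin n) K) (Fin m → MvPolynomial (Fin n) K)) :
    IsMonomialClosed (LMset ord F (N : Set (Fin m → MvPolynomial (Fin n) K))) := by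
  intro s hs δ
  rw [mem_LMset] at hs ⊢
  obtain ⟨u, hu, hus⟩ := hs
  exact ⟨_, N.smul_mem (monomial δ 1) hu,
    hus.monomial_smul (isTermKey_schreyerKey ord F) δ one_ne_zero⟩

theorem LMset_mono {S S' : Set (Fin m → MvPolynomial (Fin n) K)} (h : S ⊆ S') :
    LMset ord F S ⊆ LMset ord F S' :=
  fun _ ⟨u, hu, hus⟩ => ⟨u, h hu, hus⟩

theorem le_of_LMset_subset
    {N N' : Submodule (MvPolynomial (Fin n) K) (Fin m → MvPolynomial (Fin n) K)} (hN : N ≤ N')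
    (h : LMset ord F (N' : Set (Fin m → MvPolynomial (Fin n) K)) ⊆ LMset ord F (N : Set _)) :
    N' ≤ N :=
  le_of_leads_subset (isTermKey_schreyerKey ord F) hN fun u hu _ hus =>
    (mem_LMset ord F).1 (h ((mem_LMset ord F).2 ⟨u, hu, hus⟩))

end Schreyer

/-! ### Syzygies of the leading terms and Gröbner bases -/

section Syzygies

theorem mem_Syz {A : Type u} [CommRing A] {m : ℕ} {F u : Fin m → A} :
    u ∈ Syz F ↔ ∑ i, u i * F i = 0 := by
  rw [Syz, LinearMap.mem_ker, Fintype.linearCombination_apply]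
  rfl

theorem mem_idealOf {A : Type u} [CommRing A] {m : ℕ} {F : Fin m → A} {g : A} :
    g ∈ idealOf F ↔ ∃ u : Fin m → A, ∑ i, u i * F i = g := by
  rw [idealOf, Ideal.span, Submodule.mem_span_range_iff_exists_fun]
  rfl

variable {K : Type u} [Field K] {n m : ℕ} (ord : MonomialOrder.{0, v} (Fin n))
  (F : Fin m → MvPolynomial (Fin n) K)

/-- The tuple of leading terms, with their coefficients. -/
def initTuple : Fin m → MvPolynomial (Fin n) K :=
  fun i => monomial (ord.degree (F i)) (ord.leadingCoeff (F i))

/-- The part of `u` of multidegree `β`, when `eᵢ` has the degree of `fᵢ`. -/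
def multidegreePart (β : Fin n →₀ ℕ) (u : Fin m → MvPolynomial (Fin n) K) :
    Fin m → MvPolynomial (Fin n) K :=
  fun i => if ord.degree (F i) ≤ β then
    monomial (β - ord.degree (F i)) (coeff (β - ord.degree (F i)) (u i)) else 0

theorem coeff_multidegreePart (β : Fin n →₀ ℕ) (u : Fin m → MvPolynomial (Fin n) K)
    (s : (Fin n →₀ ℕ) × Fin m) :
    coeff s.1 (multidegreePart ord F β u s.2) =
      if s.1 + ord.degree (F s.2) = β then coeff s.1 (u s.2) else 0 := by
  unfold multidegreePart
  split_ifs with h1 h2 h2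
  · rw [coeff_monomial, ← h2, add_tsub_cancel_right, if_pos rfl]
  · rw [coeff_monomial, if_neg]
    rintro h
    exact h2 (by rw [← h, tsub_add_cancel_of_le h1])
  · exact absurd (h2 ▸ le_add_self) h1
  · simp

/-- The coefficient of `x^β` in `∑ uᵢ lt(fᵢ)`. -/
def leadSum (β : Fin n →₀ ℕ) (u : Fin m → MvPolynomial (Fin n) K) : K :=
  ∑ i, if ord.degree (F i) ≤ β then
    coeff (β - ord.degree (F i)) (u i) * ord.leadingCoeff (F i) else 0

theorem multidegreePart_mem_Syz {β : Fin n →₀ ℕ} {u : Fin m → MvPolynomial (Fin n) K}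
    (h : leadSum ord F β u = 0) : multidegreePart ord F β u ∈ Syz (initTuple ord F) := by
  rw [mem_Syz]
  have : ∀ i, multidegreePart ord F β u i * initTuple ord F i =
      monomial β (if ord.degree (F i) ≤ β then
        coeff (β - ord.degree (F i)) (u i) * ord.leadingCoeff (F i) else 0) := by
    intro i
    unfold multidegreePart initTuple
    split_ifs with h1
    · rw [monomial_mul, tsub_add_cancel_of_le h1]
    · simp
  simp only [this]
  rw [← map_sum]
  exact (congrArg _ h).trans (map_zero _)

theorem leadSum_eq_zero_of_mem_Syz {u : Fin m → MvPolynomial (Fin n) K}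
    (hu : u ∈ Syz (initTuple ord F)) (β : Fin n →₀ ℕ) : leadSum ord F β u = 0 := by
  rw [mem_Syz] at hu
  rw [← coeff_zero β, ← hu, coeff_sum]
  exact Finset.sum_congr rfl fun i _ => (coeff_mul_monomial' ..).symm

/-- No product of a term of `u i` with a term of `F i` exceeds `β`, so `β` is reached only through
the leading terms of the `F i`. -/
theorem coeff_sum_mul_eq_leadSum {β : Fin n →₀ ℕ} {u : Fin m → MvPolynomial (Fin n) K}
    (h : ∀ s : (Fin n →₀ ℕ) × Fin m, coeff s.1 (u s.2) ≠ 0 →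
      ord.toSyn (s.1 + ord.degree (F s.2)) ≤ ord.toSyn β) :
    coeff β (∑ i, u i * F i) = leadSum ord F β u := by
  rw [coeff_sum]
  refine Finset.sum_congr rfl fun i _ => ?_
  split_ifs with hi
  · have := ord.coeff_mul_of_add_of_degree_le (f := u i) (g := F i)
      (a := β - ord.degree (F i)) (b := ord.degree (F i)) ?_ le_rfl
    · rw [tsub_add_cancel_of_le hi] at this
      exact this
    · rw [ord.degree_le_iff]
      intro c hc
      have h1 := h (c, i) (mem_support_iff.1 hc)
      rw [← tsub_add_cancel_of_le hi] at h1
      simp only [map_add, add_le_add_iff_right] at h1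
      exact h1
  -- A contribution `a + b = β` would force `b` to be the leading exponent of `F i`, which does not
  -- divide `β` here.
  · rw [coeff_mul]
    by_contra hne
    obtain ⟨⟨a, b⟩, hab, hne⟩ := Finset.exists_ne_zero_of_sum_ne_zero hne
    rw [Finset.HasAntidiagonal.mem_antidiagonal] at hab
    have h1 := h (a, i) (left_ne_zero_of_mul hne)
    have h2 := ord.le_degree (mem_support_iff.2 (right_ne_zero_of_mul hne))
    simp only at hab h1 h2
    rw [← hab, map_add, map_add, add_le_add_iff_left] at h1
    have := ord.toSyn.injective (le_antisymm h1 h2)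
    exact hi (this ▸ hab ▸ le_add_self)

variable {ord F}

theorem toSyn_le_of_isLead {u : Fin m → MvPolynomial (Fin n) K} {s p : (Fin n →₀ ℕ) × Fin m}
    (h : IsLead (schreyerKey ord F) u s) (hp : coeff p.1 (u p.2) ≠ 0) :
    ord.toSyn (p.1 + ord.degree (F p.2)) ≤ ord.toSyn (s.1 + ord.degree (F s.2)) := by
  by_cases h' : p = s
  · rw [h']
  · have := h.2 p hp h'
    rw [schreyerKey_lt_iff] at this
    rcases this with h | h
    · exact h.le
    · exact (congrArg _ h.1).le

theorem key_lt_of_toSyn_lt {s p : (Fin n →₀ ℕ) × Fin m}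
    (h : ord.toSyn (p.1 + ord.degree (F p.2)) < ord.toSyn (s.1 + ord.degree (F s.2))) :
    schreyerKey ord F p < schreyerKey ord F s :=
  (schreyerKey_lt_iff ord F).2 (Or.inl h)

theorem isLead_multidegreePart {u : Fin m → MvPolynomial (Fin n) K} {s : (Fin n →₀ ℕ) × Fin m}
    (h : IsLead (schreyerKey ord F) u s) :
    IsLead (schreyerKey ord F) (multidegreePart ord F (s.1 + ord.degree (F s.2)) u) s := by
  refine ⟨by rw [coeff_multidegreePart, if_pos rfl]; exact h.1, fun p hp hne => ?_⟩
  rw [coeff_multidegreePart] at hp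
  exact h.2 p (fun h0 => hp (by rw [h0, ite_self])) hne

variable (ord)

/-- Rescaling each coordinate by a non-zero constant exchanges the syzygies of the two tuples and
leaves the occurring monomials unchanged. -/
theorem LSL_eq (hF : ∀ i, F i ≠ 0) :
    LSL ord F = LMset ord F (Syz (initTuple ord F) : Set (Fin m → MvPolynomial (Fin n) K)) := by
  have key : ∀ (d : Fin m → K), (∀ i, d i ≠ 0) →
      ∀ (A B : Fin m → MvPolynomial (Fin n) K), (∀ i, A i = C (d i) * B i) →
      LMset ord F (Syz A : Set (Fin m → MvPolynomial (Fin n) K)) ⊆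
        LMset ord F (Syz B : Set (Fin m → MvPolynomial (Fin n) K)) := by
    intro d hd A B hAB s hs
    rw [mem_LMset] at hs ⊢
    obtain ⟨u, hu, hus⟩ := hs
    refine ⟨fun i => C (d i) * u i, ?_, ?_, fun p hp hne => ?_⟩
    · rw [SetLike.mem_coe, mem_Syz] at hu ⊢
      rw [← hu]
      refine Finset.sum_congr rfl fun i _ => ?_
      rw [hAB]
      ring
    · rw [coeff_C_mul]
      exact mul_ne_zero (hd _) hus.1
    · rw [coeff_C_mul] at hp
      exact hus.2 p (right_ne_zero_of_mul hp) hne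
  have hlc : ∀ i, ord.leadingCoeff (F i) ≠ 0 := fun i => ord.leadingCoeff_ne_zero_iff.2 (hF i)
  refine (key (fun i => (ord.leadingCoeff (F i))⁻¹) (fun i => inv_ne_zero (hlc i)) _ _
    fun i => ?_).antisymm (key (fun i => ord.leadingCoeff (F i)) hlc _ _ fun i => ?_)
  · rw [initTuple, leadTuple, C_mul_monomial, inv_mul_cancel₀ (hlc i)]
  · rw [initTuple, leadTuple, C_mul_monomial, mul_one]

/-- Cancellation in the top multidegree says exactly that the part of `u` in that multidegree is a
syzygy of the leading terms, and this part still has leading monomial `s`. -/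
theorem mem_LSL_of_isLead (hF : ∀ i, F i ≠ 0) {u : Fin m → MvPolynomial (Fin n) K}
    {s : (Fin n →₀ ℕ) × Fin m} (h : IsLead (schreyerKey ord F) u s)
    (h0 : coeff (s.1 + ord.degree (F s.2)) (∑ i, u i * F i) = 0) : s ∈ LSL ord F := by
  rw [LSL_eq ord hF, mem_LMset]
  refine ⟨_, multidegreePart_mem_Syz ord F ?_, isLead_multidegreePart h⟩
  rw [← coeff_sum_mul_eq_leadSum ord F fun p hp => toSyn_le_of_isLead h hp, h0]

theorem LS_subset_LSL (hF : ∀ i, F i ≠ 0) : LS ord F ⊆ LSL ord F := by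
  intro s hs
  obtain ⟨u, hu, hus⟩ := (mem_LMset ord F).1 hs
  exact mem_LSL_of_isLead ord hF hus (by rw [mem_Syz.1 hu, coeff_zero])

theorem mem_idealOf_leadTuple_iff {a : Fin n →₀ ℕ} :
    monomial a (1 : K) ∈ idealOf (leadTuple ord F) ↔ ∃ i, ord.degree (F i) ≤ a := by
  have : Set.range (leadTuple ord F) =
      (fun s => monomial s (1 : K)) '' Set.range fun i => ord.degree (F i) := by
    rw [← Set.range_comp]
    rfl
  rw [idealOf, this, mem_ideal_span_monomial_image]
  simp

theorem isGroebner_iff (hF : ∀ i, F i ≠ 0) :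
    IsGroebner ord F ↔ ∀ f ∈ idealOf F, f ≠ 0 → ∃ i, ord.degree (F i) ≤ ord.degree f := by
  constructor
  · intro h f hf hf0
    rw [← mem_idealOf_leadTuple_iff (K := K), ← h]
    exact Ideal.subset_span ⟨f, hf, hf0, rfl⟩
  · intro h
    apply le_antisymm
    · rw [Ideal.span_le]
      rintro _ ⟨f, hf, hf0, rfl⟩
      exact (mem_idealOf_leadTuple_iff ord).2 (h f hf hf0)
    · rw [idealOf, Ideal.span_le]
      rintro _ ⟨i, rfl⟩
      exact Ideal.subset_span ⟨F i, Ideal.subset_span ⟨i, rfl⟩, hF i, rfl⟩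

/-- Descent over the representations of `f`: either the top multidegree survives, and is then that
of `f`, or it cancels and a syzygy of `F` makes the representation smaller. -/
theorem isGroebner_of_LSL_subset (hF : ∀ i, F i ≠ 0) (h : LSL ord F ⊆ LS ord F) :
    IsGroebner ord F := by
  rw [isGroebner_iff ord hF]
  intro f hf hf0
  have main : ∀ g, ∀ u : Fin m → MvPolynomial (Fin n) K, ∀ s, IsLead (schreyerKey ord F) u s →
      schreyerKey ord F s = g → ∑ i, u i * F i = f → ∃ i, ord.degree (F i) ≤ ord.degree f := by
    intro g
    induction g using WellFoundedLT.induction with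
    | ind g ih =>
      rintro u s hus rfl huf
      by_cases h0 : coeff (s.1 + ord.degree (F s.2)) f = 0
      · have hs := h (mem_LSL_of_isLead ord hF hus (by rw [huf, h0]))
        obtain ⟨w, hw, hws⟩ := (mem_LMset ord F).1 hs
        set u' := u - (C (coeff s.1 (u s.2) / coeff s.1 (w s.2)) : MvPolynomial (Fin n) K) • w
          with hu'
        have hsum : ∑ i, u' i * F i = f := by
          rw [SetLike.mem_coe, mem_Syz] at hw
          simp only [hu', Pi.sub_apply, Pi.smul_apply, smul_eq_mul, sub_mul,
            Finset.sum_sub_distrib, huf, mul_assoc, ← Finset.mul_sum, hw, mul_zero, sub_zero]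
        have hne : u' ≠ 0 := by
          intro h0'
          rw [h0'] at hsum
          exact hf0 (by simpa using hsum.symm)
        obtain ⟨s', hs'⟩ := exists_isLead (isTermKey_schreyerKey ord F) hne
        exact ih _ (key_lt_of_coeff_sub hus hws hs'.1) u' s' hs' rfl hsum
      -- No cancellation: the top multidegree occurs in `f` and bounds all its monomials, so it is
      -- the degree of `f`, a multiple of a leading monomial of `F`.
      · have h1 : ord.toSyn (ord.degree f) ≤ ord.toSyn (s.1 + ord.degree (F s.2)) := by
          rw [ord.degree_le_iff]
          intro c hc
          rw [mem_support_iff, ← huf, coeff_sum] at hc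
          obtain ⟨i, -, hi⟩ := Finset.exists_ne_zero_of_sum_ne_zero hc
          rw [coeff_mul] at hi
          obtain ⟨⟨a, b⟩, hab, hne⟩ := Finset.exists_ne_zero_of_sum_ne_zero hi
          rw [Finset.HasAntidiagonal.mem_antidiagonal] at hab
          have h2 := ord.le_degree (mem_support_iff.2 (right_ne_zero_of_mul hne))
          have h3 := toSyn_le_of_isLead (p := (a, i)) hus (left_ne_zero_of_mul hne)
          refine le_trans ?_ h3
          simp only at hab h2 ⊢
          rw [← hab, map_add, map_add]
          gcongr
        have h2 := ord.le_degree (mem_support_iff.2 h0)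
        refine ⟨s.2, ?_⟩
        rw [ord.toSyn.injective (le_antisymm h1 h2)]
        exact le_add_self
  obtain ⟨u, hu⟩ := mem_idealOf.1 hf
  have hne : u ≠ 0 := by
    rintro rfl
    exact hf0 (by simpa using hu.symm)
  obtain ⟨s, hs⟩ := exists_isLead (isTermKey_schreyerKey ord F) hne
  exact main _ u s hs rfl hu

/-- Standard representations: a set `P` of monomials that is closed under reduction by `F` and
contains the monomials of `g` contains the leading monomials of a representation of `g`. -/
theorem IsGroebner.exists_representation (hF : ∀ i, F i ≠ 0) (hG : IsGroebner ord F)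
    (P : (Fin n →₀ ℕ) → Prop)
    (hP : ∀ i δ, P (δ + ord.degree (F i)) → ∀ ε ∈ (F i).support, P (δ + ε))
    {g : MvPolynomial (Fin n) K} (hg : g ∈ idealOf F) (hgP : ∀ γ ∈ g.support, P γ) :
    ∃ h : Fin m → MvPolynomial (Fin n) K, ∑ i, h i * F i = g ∧
      ∀ i, ∀ δ ∈ (h i).support, P (δ + ord.degree (F i)) := by
  rw [isGroebner_iff ord hF] at hG
  have main : ∀ b : ord.syn, ∀ g ∈ idealOf F, (∀ γ ∈ g.support, P γ) →
      ord.toSyn (ord.degree g) = b → ∃ h : Fin m → MvPolynomial (Fin n) K, ∑ i, h i * F i = g ∧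
      ∀ i, ∀ δ ∈ (h i).support, P (δ + ord.degree (F i)) := by
    intro b
    induction b using WellFoundedLT.induction with
    | ind b ih =>
      rintro g hg hgP rfl
      by_cases hg0 : g = 0
      · exact ⟨0, by simp [hg0], by simp⟩
      obtain ⟨i, hi⟩ := hG g hg hg0
      set δ := ord.degree g - ord.degree (F i) with hδ
      have hδi : δ + ord.degree (F i) = ord.degree g := tsub_add_cancel_of_le hi
      set c := ord.leadingCoeff g / ord.leadingCoeff (F i) with hc
      have hlc : ord.leadingCoeff (F i) ≠ 0 := ord.leadingCoeff_ne_zero_iff.2 (hF i)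
      have hPδ : P (δ + ord.degree (F i)) := by
        rw [hδi]
        exact hgP _ (ord.degree_mem_support hg0)
      set g' := g - monomial δ c * F i with hg'
      have hg'mem : g' ∈ idealOf F :=
        Ideal.sub_mem _ hg (Ideal.mul_mem_left _ _ (Ideal.subset_span ⟨i, rfl⟩))
      have hsupp : ∀ γ ∈ g'.support, γ ∈ g.support ∨ ∃ ε ∈ (F i).support, γ = δ + ε := by
        intro γ hγ
        rw [mem_support_iff, hg', coeff_sub] at hγ
        by_cases h1 : coeff γ g = 0
        · right
          rw [h1, coeff_monomial_mul'] at hγ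
          split_ifs at hγ with hle
          · refine ⟨γ - δ, ?_, (add_tsub_cancel_of_le hle).symm⟩
            rw [mem_support_iff]
            intro h0
            simp [h0] at hγ
          · simp at hγ
        · exact Or.inl (mem_support_iff.2 h1)
      have hg'P : ∀ γ ∈ g'.support, P γ := by
        intro γ hγ
        rcases hsupp γ hγ with h | ⟨ε, hε, rfl⟩
        · exact hgP γ h
        · exact hP i δ hPδ ε hε
      have hco : coeff (ord.degree g) g' = 0 := by
        rw [hg', coeff_sub, ← hδi, coeff_monomial_mul, hδi]
        change ord.leadingCoeff g - c * ord.leadingCoeff (F i) = 0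
        rw [hc, div_mul_cancel₀ _ hlc, sub_self]
      have hlt : ∀ γ ∈ g'.support, ord.toSyn γ < ord.toSyn (ord.degree g) := by
        intro γ hγ
        refine lt_of_le_of_ne ?_ fun h => ?_
        · rcases hsupp γ hγ with h | ⟨ε, hε, rfl⟩
          · exact ord.le_degree h
          · rw [← hδi, map_add, map_add]
            gcongr
            exact ord.le_degree hε
        · rw [ord.toSyn.injective h] at hγ
          exact mem_support_iff.1 hγ hco
      have hrec : ∃ h : Fin m → MvPolynomial (Fin n) K, ∑ i, h i * F i = g' ∧
          ∀ i, ∀ δ ∈ (h i).support, P (δ + ord.degree (F i)) := by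
        by_cases h0 : g' = 0
        · exact ⟨0, by simp [h0], by simp⟩
        · exact ih _ (hlt _ (ord.degree_mem_support h0)) g' hg'mem hg'P rfl
      obtain ⟨h, hh, hhP⟩ := hrec
      refine ⟨h + term (δ, i) c, ?_, ?_⟩
      · simp only [Pi.add_apply, add_mul, Finset.sum_add_distrib, hh]
        rw [Finset.sum_eq_single i]
        · simp [term, hg']
        · intro j _ hj
          simp [term, Pi.single_eq_of_ne hj]
        · simp
      · intro j ε hε
        rw [mem_support_iff, Pi.add_apply, coeff_add] at hε
        by_cases h1 : coeff ε (h j) = 0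
        · have h2 := coeff_term (δ, i) (ε, j) c
          simp only at h2
          rw [h1, zero_add, h2] at hε
          have : (δ, i) = (ε, j) := by
            by_contra h3
            exact hε (if_neg h3)
          rw [Prod.mk.injEq] at this
          rw [← this.1, ← this.2]
          exact hPδ
        · exact hhP j ε (mem_support_iff.2 h1)
  exact main _ g hg hgP rfl

/-- The weight `ω` picks out the leading monomial of each `fᵢ`. -/
def IsWeightLeading (ord : MonomialOrder.{0, v} (Fin n)) (F : Fin m → MvPolynomial (Fin n) K)
    (ω : Fin n → ℕ) : Prop :=
  ∀ i, ∀ ε ∈ (F i).support, ε ≠ ord.degree (F i) →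
    Finsupp.weight ω ε < Finsupp.weight ω (ord.degree (F i))

theorem IsCompatible.isWeightLeading (hF : ∀ i, F i ≠ 0) {ω : Fin n → ℕ}
    (h : IsCompatible ord ω (monomialsOf F)) : IsWeightLeading ord F ω := by
  intro i ε hε hne
  rw [← h.2 ε ⟨i, hε⟩ _ ⟨i, ord.degree_mem_support (hF i)⟩]
  exact (ord.le_degree hε).lt_of_ne fun h => hne (ord.toSyn.injective h)

variable {ord}

theorem IsWeightLeading.le {ω : Fin n → ℕ} (h : IsWeightLeading ord F ω) {i : Fin m}
    {ε : Fin n →₀ ℕ} (hε : ε ∈ (F i).support) :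
    Finsupp.weight ω ε ≤ Finsupp.weight ω (ord.degree (F i)) := by
  by_cases h' : ε = ord.degree (F i)
  · rw [h']
  · exact (h i ε hε h').le

theorem IsWeightLeading.weightedTotalDegree_eq (hF : ∀ i, F i ≠ 0) {ω : Fin n → ℕ}
    (h : IsWeightLeading ord F ω) (i : Fin m) :
    weightedTotalDegree ω (F i) = Finsupp.weight ω (ord.degree (F i)) :=
  le_antisymm (Finset.sup_le fun _ hε => h.le hε)
    (le_weightedTotalDegree ω (ord.degree_mem_support (hF i)))

theorem IsWeightLeading.wdegMon_eq (hF : ∀ i, F i ≠ 0) {ω : Fin n → ℕ}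
    (h : IsWeightLeading ord F ω) (α : Fin n →₀ ℕ) (i : Fin m) :
    wdegMon F ω α i = Finsupp.weight ω (α + ord.degree (F i)) := by
  rw [wdegMon, h.weightedTotalDegree_eq hF, map_add]

/-- Take a syzygy `v` of the leading terms, homogeneous of multidegree `β`. In ∑ vᵢfᵢ everything at
`β` cancels; dividing the rest by `F` and subtracting the quotients from `v` gives a syzygy of `F`.
-/
theorem IsGroebner.exists_syzygy (hF : ∀ i, F i ≠ 0) (hG : IsGroebner ord F) {ω : Fin n → ℕ}
    (hω : IsWeightLeading ord F ω) {s : (Fin n →₀ ℕ) × Fin m} (hs : s ∈ LSL ord F) :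
    ∃ u ∈ Syz F, IsLead (schreyerKey ord F) u s ∧
      ∀ p : (Fin n →₀ ℕ) × Fin m, coeff p.1 (u p.2) ≠ 0 →
        wdegMon F ω p.1 p.2 ≤ wdegMon F ω s.1 s.2 := by
  rw [LSL_eq ord hF, mem_LMset] at hs
  obtain ⟨v₀, hv₀, hv₀s⟩ := hs
  set β := s.1 + ord.degree (F s.2) with hβ
  set v := multidegreePart ord F β v₀ with hv
  have hvs : IsLead (schreyerKey ord F) v s := isLead_multidegreePart hv₀s
  have hvβ : ∀ p : (Fin n →₀ ℕ) × Fin m, coeff p.1 (v p.2) ≠ 0 → p.1 + ord.degree (F p.2) = β := by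
    intro p hp
    rw [hv, coeff_multidegreePart] at hp
    by_contra h
    exact hp (if_neg h)
  have hvS : v ∈ Syz (initTuple ord F) :=
    multidegreePart_mem_Syz ord F (leadSum_eq_zero_of_mem_Syz ord F hv₀ β)
  -- Division preserves both bounds at once: the first keeps the correction below `s` in the
  -- Schreyer order, the second keeps it within the ω-degree of `s`.
  set P : (Fin n →₀ ℕ) → Prop := fun γ =>
    ord.toSyn γ < ord.toSyn β ∧ Finsupp.weight ω γ < Finsupp.weight ω β with hPdef
  have hPcl : ∀ i δ, P (δ + ord.degree (F i)) → ∀ ε ∈ (F i).support, P (δ + ε) := by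
    rintro i δ ⟨h1, h2⟩ ε hε
    refine ⟨lt_of_le_of_lt ?_ h1, lt_of_le_of_lt ?_ h2⟩
    · rw [map_add, map_add]
      gcongr
      exact ord.le_degree hε
    · rw [map_add, map_add]
      gcongr
      exact hω.le hε
  have hgP : ∀ γ ∈ (∑ i, v i * F i).support, P γ := by
    intro γ hγ
    have hγβ : γ ≠ β := by
      rintro rfl
      rw [mem_support_iff, coeff_sum_mul_eq_leadSum ord F fun p hp => toSyn_le_of_isLead hvs hp]
        at hγ
      exact hγ (leadSum_eq_zero_of_mem_Syz ord F hvS _)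
    rw [mem_support_iff, coeff_sum] at hγ
    obtain ⟨i, -, hi⟩ := Finset.exists_ne_zero_of_sum_ne_zero hγ
    rw [coeff_mul] at hi
    obtain ⟨⟨a, b⟩, hab, hne⟩ := Finset.exists_ne_zero_of_sum_ne_zero hi
    rw [Finset.HasAntidiagonal.mem_antidiagonal] at hab
    have hb := mem_support_iff.2 (right_ne_zero_of_mul hne)
    have ha := hvβ (a, i) (left_ne_zero_of_mul hne)
    simp only at hab hb ha
    have hbne : b ≠ ord.degree (F i) := by
      rintro rfl
      exact hγβ (hab.symm.trans ha)
    rw [hPdef]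
    simp only
    rw [← hab, ← ha]
    constructor
    · rw [map_add, map_add]
      refine add_lt_add_right ?_ _
      exact (ord.le_degree hb).lt_of_ne fun h => hbne (ord.toSyn.injective h)
    · rw [map_add, map_add]
      exact add_lt_add_right (hω i b hb hbne) _
  obtain ⟨h, hh, hhP⟩ := hG.exists_representation ord hF P hPcl (mem_idealOf.2 ⟨v, rfl⟩) hgP
  refine ⟨v - h, ?_, ⟨?_, ?_⟩, ?_⟩
  · rw [mem_Syz]
    simp only [Pi.sub_apply, sub_mul, Finset.sum_sub_distrib, hh, sub_self]
  · rw [Pi.sub_apply, coeff_sub]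
    have : coeff s.1 (h s.2) = 0 := by
      by_contra h0
      exact lt_irrefl _ (hhP s.2 s.1 (mem_support_iff.2 h0)).1
    rw [this, sub_zero]
    exact hvs.1
  · intro p hp hne
    rw [Pi.sub_apply, coeff_sub] at hp
    by_cases h0 : coeff p.1 (h p.2) = 0
    · exact hvs.2 p (by simpa [h0] using hp) hne
    · exact key_lt_of_toSyn_lt (hhP p.2 p.1 (mem_support_iff.2 h0)).1
  · intro p hp
    rw [hω.wdegMon_eq hF, hω.wdegMon_eq hF]
    rw [Pi.sub_apply, coeff_sub] at hp
    by_cases h0 : coeff p.1 (h p.2) = 0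
    · rw [hvβ p (by simpa [h0] using hp)]
    · exact (hhP p.2 p.1 (mem_support_iff.2 h0)).2.le

theorem isGroebner_iff_LSL_subset (hF : ∀ i, F i ≠ 0) {ω : Fin n → ℕ}
    (hω : IsWeightLeading ord F ω) : IsGroebner ord F ↔ LSL ord F ⊆ LS ord F := by
  refine ⟨fun hG s hs => ?_, isGroebner_of_LSL_subset ord hF⟩
  obtain ⟨u, hu, hus, -⟩ := hG.exists_syzygy hF hω hs
  exact (mem_LMset ord F).2 ⟨u, hu, hus⟩

end Syzygies

/-! ### The substitution `x_k ↦ t^(ω_k) x_k` -/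

section Substitution

variable {K : Type u} [Field K] {n m : ℕ} (ω : Fin n → ℕ)

section ScaleVars

variable {S : Type*} [CommRing S]

/-- The substitution `x_k ↦ b^(ω_k) x_k`. -/
def scaleVars (b : S) : MvPolynomial (Fin n) S →ₐ[S] MvPolynomial (Fin n) S :=
  aeval fun k => C (b ^ ω k) * X k

theorem scaleVars_monomial (b : S) (γ : Fin n →₀ ℕ) (p : S) :
    scaleVars ω b (monomial γ p) = monomial γ (p * b ^ Finsupp.weight ω γ) := by
  have h : C (b ^ Finsupp.weight ω γ) =
      γ.prod fun k e => (C (b ^ ω k) : MvPolynomial (Fin n) S) ^ e := by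
    rw [Finsupp.weight_apply, Finsupp.sum, ← Finset.prod_pow_eq_pow_sum, map_prod, Finsupp.prod]
    refine Finset.prod_congr rfl fun k _ => ?_
    rw [← map_pow, ← pow_mul, smul_eq_mul, mul_comm]
  rw [scaleVars, aeval_monomial, algebraMap_eq]
  simp only [mul_pow]
  rw [Finsupp.prod_mul, ← h, ← mul_assoc, ← C_mul, ← monomial_eq]

theorem coeff_scaleVars (b : S) (g : MvPolynomial (Fin n) S) (γ : Fin n →₀ ℕ) :
    coeff γ (scaleVars ω b g) = coeff γ g * b ^ Finsupp.weight ω γ := by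
  induction g using MvPolynomial.induction_on' with
  | monomial a p =>
    rw [scaleVars_monomial, coeff_monomial, coeff_monomial]
    split_ifs with h
    · rw [h]
    · rw [zero_mul]
  | add p q hp hq => rw [map_add, coeff_add, coeff_add, hp, hq, add_mul]

end ScaleVars

/-- The substitution `x_k ↦ t^(ω_k) x_k` of `R[t]`. -/
def weightSubst : MvPolynomial (Fin n) (Polynomial K) →ₐ[Polynomial K]
    MvPolynomial (Fin n) (Polynomial K) :=
  scaleVars ω Polynomial.X

theorem coeff_weightSubst (g : MvPolynomial (Fin n) (Polynomial K)) (γ : Fin n →₀ ℕ) :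
    coeff γ (weightSubst ω g) = coeff γ g * Polynomial.X ^ Finsupp.weight ω γ :=
  coeff_scaleVars ω _ g γ

theorem weightSubst_injective :
    Function.Injective (weightSubst ω : MvPolynomial (Fin n) (Polynomial K) → _) := by
  rw [injective_iff_map_eq_zero]
  intro g hg
  ext1 γ
  have := coeff_weightSubst ω g γ
  rw [hg, coeff_zero] at this
  rw [coeff_zero]
  exact (mul_eq_zero.1 this.symm).resolve_right (pow_ne_zero _ Polynomial.X_ne_zero)

theorem coeff_homogenize (f : MvPolynomial (Fin n) K) (γ : Fin n →₀ ℕ) :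
    coeff γ (homogenize ω f) = Polynomial.C (coeff γ f) *
      Polynomial.X ^ (weightedTotalDegree ω f - Finsupp.weight ω γ) := by
  rw [homogenize, coeff_sum]
  simp only [coeff_monomial]
  rw [Finset.sum_ite_eq']
  split_ifs with h
  · rfl
  · rw [notMem_support_iff.1 h, map_zero, zero_mul]

/-- The power of `t` gained at each monomial fills exactly the gap left by homogenization, so the
family becomes constant up to powers of `t`. -/
theorem weightSubst_homogenize (f : MvPolynomial (Fin n) K) :
    weightSubst ω (homogenize ω f) =
      C (Polynomial.X ^ weightedTotalDegree ω f) * MvPolynomial.map Polynomial.C f := by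
  ext1 γ
  rw [coeff_weightSubst, coeff_homogenize, coeff_C_mul, coeff_map]
  by_cases h : coeff γ f = 0
  · simp [h]
  · rw [mul_assoc, ← pow_add, Nat.sub_add_cancel
      (le_weightedTotalDegree ω (mem_support_iff.2 h)), mul_comm]

/-- The coefficient of `t^D` in an element of `R[t]`. -/
def tCoeff (D : ℕ) (g : MvPolynomial (Fin n) (Polynomial K)) : MvPolynomial (Fin n) K :=
  ∑ γ ∈ g.support, monomial γ ((coeff γ g).coeff D)

theorem coeff_tCoeff (D : ℕ) (g : MvPolynomial (Fin n) (Polynomial K)) (γ : Fin n →₀ ℕ) :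
    coeff γ (tCoeff D g) = (coeff γ g).coeff D := by
  rw [tCoeff, coeff_sum]
  simp only [coeff_monomial]
  rw [Finset.sum_ite_eq']
  split_ifs with h
  · rfl
  · rw [notMem_support_iff.1 h, Polynomial.coeff_zero]

theorem tCoeff_zero (D : ℕ) : tCoeff D (0 : MvPolynomial (Fin n) (Polynomial K)) = 0 := by
  simp [tCoeff]

theorem tCoeff_sum {ι : Type*} (D : ℕ) (s : Finset ι)
    (g : ι → MvPolynomial (Fin n) (Polynomial K)) :
    tCoeff D (∑ i ∈ s, g i) = ∑ i ∈ s, tCoeff D (g i) := by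
  ext1 γ
  rw [coeff_tCoeff, coeff_sum, coeff_sum, Polynomial.finsetSum_coeff]
  simp only [coeff_tCoeff]

/-- Taking the coefficient of `t^D` is R-linear; relations over R[t] with constant right factors
thus yield relations over R. -/
theorem tCoeff_mul_map (D : ℕ) (g : MvPolynomial (Fin n) (Polynomial K))
    (f : MvPolynomial (Fin n) K) :
    tCoeff D (g * MvPolynomial.map Polynomial.C f) = tCoeff D g * f := by
  ext1 γ
  rw [coeff_tCoeff, coeff_mul, coeff_mul, Polynomial.finsetSum_coeff]
  refine Finset.sum_congr rfl fun x _ => ?_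
  rw [coeff_map, Polynomial.coeff_mul_C, coeff_tCoeff]

theorem tCoeff_C_mul (D : ℕ) (p : Polynomial K) (g : MvPolynomial (Fin n) (Polynomial K)) :
    tCoeff D (C p * g) =
      ∑ x ∈ Finset.HasAntidiagonal.antidiagonal D, C (p.coeff x.1) * tCoeff x.2 g := by
  ext1 γ
  rw [coeff_tCoeff, coeff_C_mul, Polynomial.coeff_mul, coeff_sum]
  refine Finset.sum_congr rfl fun x _ => ?_
  rw [coeff_C_mul, coeff_tCoeff]

theorem exists_sum_tCoeff (g : MvPolynomial (Fin n) (Polynomial K)) :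
    ∃ M, g = ∑ D ∈ Finset.range M,
      C (Polynomial.X ^ D) * MvPolynomial.map Polynomial.C (tCoeff D g) := by
  refine ⟨g.support.sup (fun γ => (coeff γ g).natDegree) + 1, ?_⟩
  ext1 γ
  rw [coeff_sum]
  simp only [coeff_C_mul, coeff_map, coeff_tCoeff]
  simp only [Polynomial.X_pow_mul_C]
  refine Polynomial.as_sum_range_C_mul_X_pow' _ ?_
  by_cases h : γ ∈ g.support
  · exact Nat.lt_succ_of_le (Finset.le_sup (f := fun γ => (coeff γ g).natDegree) h)
  · rw [notMem_support_iff.1 h]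
    simp

end Substitution

/-! ### Homogenization of syzygies and the image of `φ` -/

section ImPhi

variable {K : Type u} [Field K] {n m : ℕ} (ω : Fin n → ℕ) (F : Fin m → MvPolynomial (Fin n) K)

/-- The homogenization of `u ∈ R^m` in degree `D`. -/
def freeHomogenize (D : ℕ) (u : Fin m → MvPolynomial (Fin n) K) :
    Fin m → MvPolynomial (Fin n) (Polynomial K) :=
  fun i => ∑ α ∈ (u i).support,
    monomial α (Polynomial.C (coeff α (u i)) * Polynomial.X ^ (D - wdegMon F ω α i))

theorem coeff_freeHomogenize (D : ℕ) (u : Fin m → MvPolynomial (Fin n) K)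
    (α : Fin n →₀ ℕ) (i : Fin m) :
    coeff α (freeHomogenize ω F D u i) =
      Polynomial.C (coeff α (u i)) * Polynomial.X ^ (D - wdegMon F ω α i) := by
  rw [freeHomogenize, coeff_sum]
  simp only [coeff_monomial]
  rw [Finset.sum_ite_eq']
  split_ifs with h
  · rfl
  · rw [notMem_support_iff.1 h, map_zero, zero_mul]

variable {ω F} in
theorem weightSubst_sum_freeHomogenize {D : ℕ} {u : Fin m → MvPolynomial (Fin n) K}
    (h : ∀ p : (Fin n →₀ ℕ) × Fin m, coeff p.1 (u p.2) ≠ 0 → wdegMon F ω p.1 p.2 ≤ D) :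
    weightSubst ω (∑ i, freeHomogenize ω F D u i * homTuple ω F i) =
      C (Polynomial.X ^ D) * MvPolynomial.map Polynomial.C (∑ i, u i * F i) := by
  rw [map_sum, map_sum, Finset.mul_sum]
  refine Finset.sum_congr rfl fun i _ => ?_
  rw [map_mul, map_mul, homTuple, weightSubst_homogenize, ← mul_assoc, ← mul_assoc]
  congr 1
  ext1 γ
  rw [mul_comm, coeff_C_mul, coeff_weightSubst, coeff_freeHomogenize, coeff_C_mul, coeff_map]
  by_cases h0 : coeff γ (u i) = 0
  · simp [h0]
  · have h1 := h (γ, i) h0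
    -- The bound `h1` makes the truncated subtraction exact.
    have h2 : weightedTotalDegree ω (F i) + (D - wdegMon F ω γ i + Finsupp.weight ω γ) = D := by
      simp only [wdegMon] at h1 ⊢
      omega
    rw [mul_assoc, ← pow_add, mul_left_comm, ← pow_add, h2, mul_comm]

/-- The part of degree `D` of `u ∈ R^m`. -/
def degreePart (D : ℕ) (u : Fin m → MvPolynomial (Fin n) K) : Fin m → MvPolynomial (Fin n) K :=
  fun i => ∑ α ∈ (u i).support with wdegMon F ω α i = D, monomial α (coeff α (u i))

theorem coeff_degreePart (D : ℕ) (u : Fin m → MvPolynomial (Fin n) K) (s : (Fin n →₀ ℕ) × Fin m) :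
    coeff s.1 (degreePart ω F D u s.2) =
      if wdegMon F ω s.1 s.2 = D then coeff s.1 (u s.2) else 0 := by
  rw [degreePart, coeff_sum]
  simp only [coeff_monomial]
  rw [Finset.sum_ite_eq']
  simp only [Finset.mem_filter]
  split_ifs with h1 h2 h2
  · rfl
  · exact absurd h1.2 h2
  · by_contra h3
    exact h1 ⟨mem_support_iff.2 (Ne.symm h3), h2⟩
  · rfl

theorem setTZero_apply (w : Fin m → MvPolynomial (Fin n) (Polynomial K)) (i : Fin m) :
    setTZero K n m w i = MvPolynomial.map Polynomial.constantCoeff (w i) := rfl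

/-- Classes modulo `t` lift to constants of K, so the value of `phi` at any tensor is the value at t
= 0 of a single syzygy. -/
theorem mem_range_phi {v : Fin m → MvPolynomial (Fin n) K} :
    v ∈ Set.range (phi ω F) ↔ ∃ w ∈ Syz (homTuple ω F), setTZero K n m w = v := by
  constructor
  · rintro ⟨z, rfl⟩
    induction z using TensorProduct.induction_on with
    | zero => exact ⟨0, Submodule.zero_mem _, by rw [map_zero, map_zero]⟩
    | tmul w c =>
      refine ⟨(C (Polynomial.C (residueToField K c)) : MvPolynomial (Fin n) (Polynomial K)) • w.1,
        Submodule.smul_mem _ _ w.2, ?_⟩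
      change _ = residueToField K c • setTZero K n m w.1
      ext1 i
      simp [setTZero, smul_eq_C_mul]
    | add x y hx hy =>
      obtain ⟨a, ha, hax⟩ := hx
      obtain ⟨b, hb, hby⟩ := hy
      exact ⟨a + b, Submodule.add_mem _ ha hb, by rw [map_add, map_add, hax, hby]⟩
  · rintro ⟨w, hw, rfl⟩
    refine ⟨(⟨w, hw⟩ : Syz (homTuple ω F)) ⊗ₜ 1, ?_⟩
    change residueToField K 1 • setTZero K n m w = _
    rw [map_one, one_smul]

/-- The image of `φ`, as a submodule of `R^m`. -/
def imPhi : Submodule (MvPolynomial (Fin n) K) (Fin m → MvPolynomial (Fin n) K) where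
  carrier := Set.range (phi ω F)
  zero_mem' := ⟨0, map_zero _⟩
  add_mem' := by
    rintro _ _ ⟨a, rfl⟩ ⟨b, rfl⟩
    exact ⟨a + b, map_add _ _ _⟩
  smul_mem' := by
    intro r v hv
    rw [mem_range_phi] at hv ⊢
    obtain ⟨w, hw, rfl⟩ := hv
    refine ⟨MvPolynomial.map Polynomial.C r • w, Submodule.smul_mem _ _ hw, ?_⟩
    ext1 i
    have : (Polynomial.constantCoeff.comp Polynomial.C : K →+* K) = RingHom.id K := by
      ext; simp
    simp [setTZero, MvPolynomial.map_map, this, MvPolynomial.map_id]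

theorem mem_imPhi {v : Fin m → MvPolynomial (Fin n) K} :
    v ∈ imPhi ω F ↔ ∃ w ∈ Syz (homTuple ω F), setTZero K n m w = v :=
  mem_range_phi ω F

theorem coe_imPhi : (imPhi ω F : Set (Fin m → MvPolynomial (Fin n) K)) = Set.range (phi ω F) :=
  rfl

variable {ω F}

/-- Homogenizing `u` in degree `D` gives a syzygy of F^(t), and at t = 0 only the terms of degree
exactly `D` survive. -/
theorem degreePart_mem_imPhi {D : ℕ} {u : Fin m → MvPolynomial (Fin n) K} (hu : u ∈ Syz F)
    (h : ∀ p : (Fin n →₀ ℕ) × Fin m, coeff p.1 (u p.2) ≠ 0 → wdegMon F ω p.1 p.2 ≤ D) :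
    degreePart ω F D u ∈ imPhi ω F := by
  rw [mem_imPhi]
  refine ⟨freeHomogenize ω F D u, ?_, free_ext fun s => ?_⟩
  · rw [mem_Syz]
    apply weightSubst_injective ω
    rw [weightSubst_sum_freeHomogenize h, mem_Syz.1 hu, map_zero, mul_zero, map_zero]
  · rw [setTZero_apply, coeff_map, coeff_freeHomogenize, coeff_degreePart, map_mul, map_pow,
      Polynomial.constantCoeff_apply, Polynomial.constantCoeff_apply, Polynomial.coeff_C_zero,
      Polynomial.coeff_X_zero]
    by_cases h0 : coeff s.1 (u s.2) = 0
    · simp [h0]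
    · have := h s h0
      split_ifs with h1
      · rw [h1, Nat.sub_self, pow_zero, mul_one]
      · rw [zero_pow (by omega), mul_zero]

theorem exists_syzygy_of_mem_imPhi {v : Fin m → MvPolynomial (Fin n) K} (hv : v ∈ imPhi ω F)
    (D : ℕ) : ∃ u ∈ Syz F,
      (∀ p : (Fin n →₀ ℕ) × Fin m, coeff p.1 (u p.2) ≠ 0 → wdegMon F ω p.1 p.2 ≤ D) ∧
      degreePart ω F D u = degreePart ω F D v := by
  obtain ⟨w, hw, rfl⟩ := (mem_imPhi ω F).1 hv
  -- The extra factor shifts the coefficient of x^α eᵢ by the full ω-degree of that monomial. The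
  -- coefficient of `t^D` therefore sees nothing above degree `D`, and in degree `D` sees the value
  -- of `w` at t = 0.
  set u : Fin m → MvPolynomial (Fin n) K := fun i =>
    tCoeff D (weightSubst ω (w i) * C (Polynomial.X ^ weightedTotalDegree ω (F i))) with hu
  have hcoeff : ∀ p : (Fin n →₀ ℕ) × Fin m, coeff p.1 (u p.2) =
      if wdegMon F ω p.1 p.2 ≤ D then (coeff p.1 (w p.2)).coeff (D - wdegMon F ω p.1 p.2)
        else 0 := by
    intro p
    simp only [hu]
    rw [coeff_tCoeff, mul_comm, coeff_C_mul, coeff_weightSubst, mul_comm, mul_assoc, ← pow_add,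
      Polynomial.coeff_mul_X_pow']
    rfl
  refine ⟨u, ?_, fun p hp => ?_, free_ext fun s => ?_⟩
  · rw [mem_Syz] at hw ⊢
    have h1 : weightSubst ω (∑ i, w i * homTuple ω F i) = 0 := by rw [hw, map_zero]
    have h2 := tCoeff_zero (K := K) (n := n) D
    rw [← h1, map_sum, tCoeff_sum] at h2
    rw [← h2]
    refine Finset.sum_congr rfl fun i _ => ?_
    rw [map_mul, homTuple, weightSubst_homogenize, ← mul_assoc, tCoeff_mul_map]
  · by_contra h
    exact hp (by rw [hcoeff, if_neg h])
  · rw [coeff_degreePart, coeff_degreePart]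
    split_ifs with h
    · rw [hcoeff, if_pos h.le, h, Nat.sub_self]
      rw [setTZero_apply, coeff_map, Polynomial.constantCoeff_apply]
    · rfl

variable {ord : MonomialOrder.{0, v} (Fin n)}

/-- Only the leading monomial attains the ω-degree of `F i`; every other term carries a positive
power of `t`. -/
theorem map_constantCoeff_homTuple (hF : ∀ i, F i ≠ 0) (hω : IsWeightLeading ord F ω) (i : Fin m) :
    MvPolynomial.map Polynomial.constantCoeff (homTuple ω F i) = initTuple ord F i := by
  ext1 γ
  rw [coeff_map, homTuple, coeff_homogenize, initTuple, coeff_monomial, map_mul, map_pow,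
    Polynomial.constantCoeff_apply, Polynomial.constantCoeff_apply, Polynomial.coeff_C_zero,
    Polynomial.coeff_X_zero, hω.weightedTotalDegree_eq hF]
  split_ifs with h
  · rw [← h, Nat.sub_self, pow_zero, mul_one]
    rfl
  · by_cases h0 : coeff γ (F i) = 0
    · rw [h0, zero_mul]
    · have := hω i γ (mem_support_iff.2 h0) (Ne.symm h)
      rw [zero_pow (by omega), mul_zero]

theorem imPhi_le (hF : ∀ i, F i ≠ 0) (hω : IsWeightLeading ord F ω) :
    imPhi ω F ≤ Syz (initTuple ord F) := by
  intro v hv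
  obtain ⟨w, hw, rfl⟩ := (mem_imPhi ω F).1 hv
  rw [mem_Syz] at hw ⊢
  have := congrArg (MvPolynomial.map Polynomial.constantCoeff) hw
  rw [map_sum, map_zero] at this
  rw [← this]
  refine Finset.sum_congr rfl fun i _ => ?_
  rw [map_mul, map_constantCoeff_homTuple hF hω, setTZero_apply]

theorem LImS_eq : LImS ord ω F = LMset ord F (imPhi ω F : Set (Fin m → MvPolynomial (Fin n) K)) :=
  rfl

theorem LImS_subset_LSL (hF : ∀ i, F i ≠ 0) (hω : IsWeightLeading ord F ω) :
    LImS ord ω F ⊆ LSL ord F := by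
  rw [LSL_eq ord hF]
  exact LMset_mono ord F (imPhi_le hF hω)

theorem LSL_subset_LImS_iff (hF : ∀ i, F i ≠ 0) (hω : IsWeightLeading ord F ω) :
    LSL ord F ⊆ LImS ord ω F ↔ Syz (initTuple ord F) ≤ imPhi ω F := by
  rw [LSL_eq ord hF]
  exact ⟨le_of_LMset_subset ord F (imPhi_le hF hω), fun h => LMset_mono ord F h⟩

theorem isLead_degreePart {Γ : Type*} [LinearOrder Γ] {key : (Fin n →₀ ℕ) × Fin m → Γ}
    {u : Fin m → MvPolynomial (Fin n) K} {s : (Fin n →₀ ℕ) × Fin m} (h : IsLead key u s) :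
    IsLead key (degreePart ω F (wdegMon F ω s.1 s.2) u) s := by
  refine ⟨by rw [coeff_degreePart, if_pos rfl]; exact h.1, fun p hp hne => ?_⟩
  rw [coeff_degreePart] at hp
  exact h.2 p (fun h0 => hp (by rw [h0, ite_self])) hne

/-- The degree bound on the lifted syzygy ensures that its part in the degree of `s` lies in im φ.
-/
theorem IsGroebner.LSL_subset_LImS (hF : ∀ i, F i ≠ 0) (hω : IsWeightLeading ord F ω)
    (hG : IsGroebner ord F) : LSL ord F ⊆ LImS ord ω F := by
  intro s hs
  obtain ⟨u, hu, hus, hle⟩ := hG.exists_syzygy hF hω hs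
  rw [LImS_eq, mem_LMset]
  exact ⟨_, degreePart_mem_imPhi hu hle, isLead_degreePart hus⟩

end ImPhi

/-! ### Flatness -/

section Flatness

variable {K : Type u} [Field K] {n m : ℕ} {ω : Fin n → ℕ} {F : Fin m → MvPolynomial (Fin n) K}

/-- Over the Bézout domain K[t], flatness is torsion-freeness. -/
theorem flat_family_iff {J : Ideal (MvPolynomial (Fin n) (Polynomial K))} :
    Flat (family J) ↔ ∀ p : Polynomial K, p ≠ 0 → ∀ g, C p * g ∈ J → g ∈ J := by
  rw [family, Flat.SpecMap_iff, CommRingCat.hom_ofHom, RingHom.flat_algebraMap_iff,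
    Module.Flat.flat_iff_torsion_eq_bot_of_isBezout, Submodule.eq_bot_iff]
  constructor
  · intro h p hp g hg
    rw [← Ideal.Quotient.eq_zero_iff_mem]
    apply h
    rw [Submodule.mem_torsion_iff]
    refine ⟨⟨p, mem_nonZeroDivisors_of_ne_zero hp⟩, ?_⟩
    rw [← Ideal.Quotient.eq_zero_iff_mem] at hg
    rw [Submonoid.mk_smul, Algebra.smul_def]
    rw [map_mul] at hg
    exact hg
  · intro h x hx
    rw [Submodule.mem_torsion_iff] at hx
    obtain ⟨⟨p, hp⟩, hpx⟩ := hx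
    obtain ⟨g, rfl⟩ := Ideal.Quotient.mk_surjective x
    rw [Ideal.Quotient.eq_zero_iff_mem]
    refine h p (nonZeroDivisors.ne_zero hp) g ?_
    rw [← Ideal.Quotient.eq_zero_iff_mem, map_mul]
    rw [Submonoid.mk_smul, Algebra.smul_def] at hpx
    exact hpx

theorem tCoeff_weightSubst_mem {g : MvPolynomial (Fin n) (Polynomial K)}
    (hg : g ∈ idealOf (homTuple ω F)) (D : ℕ) : tCoeff D (weightSubst ω g) ∈ idealOf F := by
  obtain ⟨u, rfl⟩ := mem_idealOf.1 hg
  rw [map_sum, tCoeff_sum]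
  refine Ideal.sum_mem _ fun i _ => ?_
  rw [map_mul, homTuple, weightSubst_homogenize, ← mul_assoc, tCoeff_mul_map]
  exact Ideal.mul_mem_left _ _ (Ideal.subset_span ⟨i, rfl⟩)

/-- Induction on `D`: modulo earlier coefficients of `g`, the first relevant coefficient of `p * g`
is the lowest coefficient of `p`, a unit, times the coefficient of `t^D` in `g`. -/
theorem tCoeff_mem_of_C_mul {I : Ideal (MvPolynomial (Fin n) K)} {p : Polynomial K} (hp : p ≠ 0)
    {g : MvPolynomial (Fin n) (Polynomial K)} (h : ∀ D, tCoeff D (C p * g) ∈ I) (D : ℕ) :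
    tCoeff D g ∈ I := by
  induction D using Nat.strong_induction_on with
  | _ D ih =>
    have h1 := h (p.natTrailingDegree + D)
    have hmem : (p.natTrailingDegree, D) ∈
        Finset.HasAntidiagonal.antidiagonal (p.natTrailingDegree + D) := by simp
    rw [tCoeff_C_mul, ← Finset.add_sum_erase _ _ hmem] at h1
    have h2 : ∑ x ∈ (Finset.HasAntidiagonal.antidiagonal (p.natTrailingDegree + D)).erase
        (p.natTrailingDegree, D), C (p.coeff x.1) * tCoeff x.2 g ∈ I := by
      refine Ideal.sum_mem _ fun x hx => ?_
      obtain ⟨a, b⟩ := x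
      rw [Finset.mem_erase, Finset.HasAntidiagonal.mem_antidiagonal] at hx
      simp only [ne_eq, Prod.mk.injEq, not_and] at hx ⊢
      rcases lt_trichotomy a p.natTrailingDegree with hlt | heq | hgt
      · rw [Polynomial.coeff_eq_zero_of_lt_natTrailingDegree hlt, map_zero, zero_mul]
        exact I.zero_mem
      · exact absurd (by omega) (hx.1 heq)
      · exact I.mul_mem_left _ (ih b (by omega))
    have h3 := (Ideal.add_mem_iff_left _ h2).1 h1
    have hne : p.coeff p.natTrailingDegree ≠ 0 := Polynomial.trailingCoeff_nonzero_iff_nonzero.2 hp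
    have h4 := I.mul_mem_left (C (p.coeff p.natTrailingDegree)⁻¹) h3
    rwa [← mul_assoc, ← map_mul, inv_mul_cancel₀ hne, map_one, one_mul] at h4

/-- Every t-coefficient of the substituted `g` has a representation by `F`; homogenizing them all in
one degree `N` that bounds these representations costs a factor `t^N`. -/
theorem exists_X_pow_mul_mem {g : MvPolynomial (Fin n) (Polynomial K)}
    (hg : ∀ D, tCoeff D (weightSubst ω g) ∈ idealOf F) :
    ∃ N, C (Polynomial.X ^ N) * g ∈ idealOf (homTuple ω F) := by
  choose w hw using fun D => mem_idealOf.1 (hg D)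
  obtain ⟨M, hM⟩ := exists_sum_tCoeff (weightSubst ω g)
  set N := (Finset.range M).sup fun D => (freeSupport (w D)).sup fun p => wdegMon F ω p.1 p.2
    with hN
  have hle : ∀ D ∈ Finset.range M, ∀ p : (Fin n →₀ ℕ) × Fin m, coeff p.1 (w D p.2) ≠ 0 →
      wdegMon F ω p.1 p.2 ≤ N := by
    intro D hD p hp
    exact (Finset.le_sup (f := fun p : (Fin n →₀ ℕ) × Fin m => wdegMon F ω p.1 p.2)
      (mem_freeSupport.2 hp)).trans (Finset.le_sup
        (f := fun D => (freeSupport (w D)).sup fun p => wdegMon F ω p.1 p.2) hD)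
  refine ⟨N, ?_⟩
  have : C (Polynomial.X ^ N) * g = ∑ D ∈ Finset.range M, C (Polynomial.X ^ D) *
      ∑ i, freeHomogenize ω F N (w D) i * homTuple ω F i := by
    apply weightSubst_injective ω
    have hC : ∀ k : ℕ, weightSubst ω (C (Polynomial.X ^ k) : MvPolynomial (Fin n) (Polynomial K)) =
        C (Polynomial.X ^ k) := fun k => (weightSubst ω).commutes _
    rw [map_mul, map_sum, hM, Finset.mul_sum, hC]
    refine Finset.sum_congr rfl fun D hD => ?_
    rw [map_mul, hC, weightSubst_sum_freeHomogenize (hle D hD), hw, mul_left_comm]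
  rw [this]
  exact Ideal.sum_mem _ fun D _ => Ideal.mul_mem_left _ _ (mem_idealOf.2 ⟨_, rfl⟩)

/-- All torsion is t-power torsion: after the substitution the ideal is extended from R, where a
non-zero `p` can be cancelled, and undoing the substitution costs only a power of `t`. -/
theorem flat_family_homTuple_iff :
    Flat (family (idealOf (homTuple ω F))) ↔
      ∀ g, C Polynomial.X * g ∈ idealOf (homTuple ω F) → g ∈ idealOf (homTuple ω F) := by
  rw [flat_family_iff]
  refine ⟨fun h => h _ Polynomial.X_ne_zero, fun h p hp g hg => ?_⟩
  have h1 : ∀ D, tCoeff D (weightSubst ω g) ∈ idealOf F := by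
    refine tCoeff_mem_of_C_mul hp fun D => ?_
    have := tCoeff_weightSubst_mem hg D
    rw [map_mul] at this
    rwa [show weightSubst ω (C p : MvPolynomial (Fin n) (Polynomial K)) = C p from
      (weightSubst ω).commutes _] at this
  obtain ⟨N, hN⟩ := exists_X_pow_mul_mem h1
  induction N with
  | zero => simpa using hN
  | succ N ih =>
    apply ih
    apply h
    rwa [← mul_assoc, ← map_mul, ← pow_succ']

theorem exists_eq_X_mul {g : MvPolynomial (Fin n) (Polynomial K)}
    (hg : MvPolynomial.map Polynomial.constantCoeff g = 0) : ∃ g', g = C Polynomial.X * g' := by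
  have : C Polynomial.X ∣ g := by
    rw [C_dvd_iff_dvd_coeff]
    intro γ
    rw [Polynomial.X_dvd_iff]
    have := congrArg (coeff γ) hg
    rwa [coeff_map, coeff_zero, Polynomial.constantCoeff_apply] at this
  exact this

variable {ord : MonomialOrder.{0, v} (Fin n)}

/-- If `s` is a syzygy at t = 0, then ∑ sᵢfᵢ^(t) = t g; writing g = ∑ wᵢfᵢ^(t) gives the lift s − t
w. Conversely, if t g = ∑ wᵢfᵢ^(t), then w at t = 0 is a syzygy, and subtracting a lift of it makes
`w` divisible by `t`. -/
theorem flat_family_iff_le_imPhi (hF : ∀ i, F i ≠ 0) (hω : IsWeightLeading ord F ω) :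
    Flat (family (idealOf (homTuple ω F))) ↔ Syz (initTuple ord F) ≤ imPhi ω F := by
  rw [flat_family_homTuple_iff]
  have hX : (C Polynomial.X : MvPolynomial (Fin n) (Polynomial K)) ≠ 0 := by
    rw [Ne, C_eq_zero]
    exact Polynomial.X_ne_zero
  have hmapX : MvPolynomial.map Polynomial.constantCoeff
      (C Polynomial.X : MvPolynomial (Fin n) (Polynomial K)) = 0 := by
    rw [map_C, Polynomial.constantCoeff_apply, Polynomial.coeff_X_zero, map_zero]
  constructor
  · intro h s hs
    have hmap : ∀ f : MvPolynomial (Fin n) K, MvPolynomial.map Polynomial.constantCoeff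
        (MvPolynomial.map Polynomial.C f) = f := by
      intro f
      ext1 γ
      simp [coeff_map]
    obtain ⟨g, hg⟩ := exists_eq_X_mul
      (g := ∑ i, MvPolynomial.map Polynomial.C (s i) * homTuple ω F i) (by
        rw [map_sum, ← mem_Syz.1 hs]
        refine Finset.sum_congr rfl fun i _ => ?_
        rw [map_mul, hmap, map_constantCoeff_homTuple hF hω])
    obtain ⟨w, hw⟩ := mem_idealOf.1 (h g (hg ▸ mem_idealOf.2 ⟨_, rfl⟩))
    rw [mem_imPhi]
    refine ⟨fun i => MvPolynomial.map Polynomial.C (s i) - C Polynomial.X * w i, ?_, ?_⟩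
    · rw [mem_Syz]
      simp only [sub_mul, Finset.sum_sub_distrib, hg, mul_assoc, ← Finset.mul_sum, hw, sub_self]
    · ext1 i
      rw [setTZero_apply, map_sub, map_mul, hmapX, zero_mul, sub_zero, hmap]
  · intro h g hg
    obtain ⟨w, hw⟩ := mem_idealOf.1 hg
    have h0 : setTZero K n m w ∈ Syz (initTuple ord F) := by
      rw [mem_Syz]
      have := congrArg (MvPolynomial.map Polynomial.constantCoeff) hw
      rw [map_mul, hmapX, zero_mul, map_sum] at this
      rw [← this]
      refine Finset.sum_congr rfl fun i _ => ?_
      rw [map_mul, map_constantCoeff_homTuple hF hω, setTZero_apply]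
    obtain ⟨w', hw', hww'⟩ := (mem_imPhi ω F).1 (h h0)
    have h1 : ∀ i, ∃ y, w i - w' i = C Polynomial.X * y := by
      intro i
      have h2 := congrFun hww' i
      rw [setTZero_apply, setTZero_apply] at h2
      exact exists_eq_X_mul (by rw [map_sub, h2, sub_self])
    choose y hy using h1
    refine mem_idealOf.2 ⟨y, mul_left_cancel₀ hX ?_⟩
    rw [← hw, Finset.mul_sum]
    simp only [← mul_assoc, ← hy, sub_mul, Finset.sum_sub_distrib]
    rw [mem_Syz.1 hw', sub_zero]

theorem flat_family_iff_LSL_subset (hF : ∀ i, F i ≠ 0) (hω : IsWeightLeading ord F ω) :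
    Flat (family (idealOf (homTuple ω F))) ↔ LSL ord F ⊆ LImS ord ω F := by
  rw [flat_family_iff_le_imPhi hF hω, LSL_subset_LImS_iff hF hω]

theorem isMonomialClosed_LImS : IsMonomialClosed (LImS ord ω F) :=
  isMonomialClosed_LMset ord F (imPhi ω F)

theorem isGroebner_iff_flat (hF : ∀ i, F i ≠ 0) (hω : IsWeightLeading ord F ω) :
    IsGroebner ord F ↔
      Flat (family (idealOf (homTuple ω F))) ∧ LS ord F = LImS ord ω F := by
  rw [flat_family_iff_LSL_subset hF hω]
  constructor
  · intro hG
    refine ⟨hG.LSL_subset_LImS hF hω, ?_⟩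
    refine ((LS_subset_LSL ord hF).trans (hG.LSL_subset_LImS hF hω)).antisymm ?_
    exact (LImS_subset_LSL hF hω).trans ((isGroebner_iff_LSL_subset hF hω).1 hG)
  · rintro ⟨h1, h2⟩
    rw [isGroebner_iff_LSL_subset hF hω, h2]
    exact h1

end Flatness

/-! ### Normal forms and comparison of initial modules for two orders -/

section NormalForm

variable {K : Type u} [Field K] {n m : ℕ} {Γ Γ' : Type*} [LinearOrder Γ] [LinearOrder Γ']

/-- Here `T` need not contain all leading monomials of `N` for `key`; below it comes from a
different order. -/
theorem exists_normalForm [WellFoundedLT Γ] {key : (Fin n →₀ ℕ) × Fin m → Γ}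
    {N : Submodule (MvPolynomial (Fin n) K) (Fin m → MvPolynomial (Fin n) K)}
    {T : Set ((Fin n →₀ ℕ) × Fin m)} (hT : ∀ p ∈ T, ∃ w ∈ N, IsLead key w p)
    (p : (Fin n →₀ ℕ) × Fin m) :
    ∃ r : Fin m → MvPolynomial (Fin n) K, term p 1 - r ∈ N ∧
      ∀ q : (Fin n →₀ ℕ) × Fin m, coeff q.1 (r q.2) ≠ 0 → key q ≤ key p ∧ q ∉ T := by
  suffices main : ∀ g, ∀ p, key p = g → ∃ r : Fin m → MvPolynomial (Fin n) K, term p 1 - r ∈ N ∧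
      ∀ q : (Fin n →₀ ℕ) × Fin m, coeff q.1 (r q.2) ≠ 0 → key q ≤ key p ∧ q ∉ T from
    main _ p rfl
  intro g
  induction g using WellFoundedLT.induction with
  | ind g ih =>
    rintro p rfl
    by_cases hp : p ∈ T
    · obtain ⟨w, hw, hwp⟩ := hT p hp
      -- Membership stands under the existential so that the choice is a total function; outside the
      -- support the value 0 is arbitrary.
      have hrec : ∀ q : (Fin n →₀ ℕ) × Fin m, ∃ r : Fin m → MvPolynomial (Fin n) K,
          q ∈ (freeSupport w).erase p → term q 1 - r ∈ N ∧
          ∀ q' : (Fin n →₀ ℕ) × Fin m, coeff q'.1 (r q'.2) ≠ 0 → key q' ≤ key q ∧ q' ∉ T := by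
        intro q
        by_cases hq : q ∈ (freeSupport w).erase p
        · rw [Finset.mem_erase, mem_freeSupport] at hq
          obtain ⟨r, hr⟩ := ih _ (hwp.2 q hq.2 hq.1) q rfl
          exact ⟨r, fun _ => hr⟩
        · exact ⟨0, fun h => absurd h hq⟩
      choose r hr using hrec
      set c := coeff p.1 (w p.2) with hc
      refine ⟨-∑ q ∈ (freeSupport w).erase p,
        (C (c⁻¹ * coeff q.1 (w q.2)) : MvPolynomial (Fin n) K) • r q, ?_, ?_⟩
      · have hw' : (C c⁻¹ : MvPolynomial (Fin n) K) • w = term p 1 +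
            ∑ q ∈ (freeSupport w).erase p,
              (C (c⁻¹ * coeff q.1 (w q.2)) : MvPolynomial (Fin n) K) • term q 1 := by
          conv_lhs => rw [← sum_term w]
          rw [Finset.smul_sum, ← Finset.add_sum_erase _ _ (mem_freeSupport.2 hwp.1)]
          congr 1
          · rw [C_apply, monomial_smul_term, add_zero, inv_mul_cancel₀ hwp.1]
          · refine Finset.sum_congr rfl fun q _ => ?_
            rw [C_apply, C_apply, monomial_smul_term, monomial_smul_term, mul_one]
        have : term p 1 - -∑ q ∈ (freeSupport w).erase p,
            (C (c⁻¹ * coeff q.1 (w q.2)) : MvPolynomial (Fin n) K) • r q =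
            (C c⁻¹ : MvPolynomial (Fin n) K) • w - ∑ q ∈ (freeSupport w).erase p,
              (C (c⁻¹ * coeff q.1 (w q.2)) : MvPolynomial (Fin n) K) • (term q 1 - r q) := by
          rw [hw']
          simp only [smul_sub, Finset.sum_sub_distrib]
          abel
        rw [this]
        exact N.sub_mem (N.smul_mem _ hw)
          (N.sum_mem fun q hq => N.smul_mem _ (hr q hq).1)
      · intro q' hq'
        rw [Pi.neg_apply, coeff_neg, neg_ne_zero, Finset.sum_apply, coeff_sum] at hq'
        obtain ⟨q, hq, hne⟩ := Finset.exists_ne_zero_of_sum_ne_zero hq'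
        rw [coeff_C_smul] at hne
        obtain ⟨h1, h2⟩ := (hr q hq).2 q' (right_ne_zero_of_mul hne)
        rw [Finset.mem_erase, mem_freeSupport] at hq
        exact ⟨h1.trans (hwp.2 q hq.2 hq.1).le, h2⟩
    · refine ⟨term p 1, by rw [sub_self]; exact N.zero_mem, fun q hq => ?_⟩
      rw [coeff_term] at hq
      obtain rfl : p = q := by
        by_contra h
        exact hq (if_neg h)
      exact ⟨le_rfl, hp⟩

/-- If every leading monomial of `N` for one order is also a leading monomial for a second order,
then the two orders have the same leading monomials. -/
theorem exists_isLead_of_isLead [WellFoundedLT Γ'] {key : (Fin n →₀ ℕ) × Fin m → Γ}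
    {key' : (Fin n →₀ ℕ) × Fin m → Γ'} (hkey : IsTermKey key)
    {N : Submodule (MvPolynomial (Fin n) K) (Fin m → MvPolynomial (Fin n) K)}
    (h : ∀ p, (∃ w ∈ N, IsLead key w p) → ∃ w ∈ N, IsLead key' w p)
    {u : Fin m → MvPolynomial (Fin n) K} (hu : u ∈ N) {s : (Fin n →₀ ℕ) × Fin m}
    (hus : IsLead key' u s) : ∃ w ∈ N, IsLead key w s := by
  set T : Set ((Fin n →₀ ℕ) × Fin m) := {p | ∃ w ∈ N, IsLead key w p} with hT
  by_contra hs
  choose r hrN hr using exists_normalForm (T := T) h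
  -- All monomials of `u` except `s` are replaced by normal forms, reduced along `key'`. The result
  -- stays in `N` and keeps `s`, yet none of its monomials lies in `T`, whereas its leading monomial
  -- for `key` must.
  set u' : Fin m → MvPolynomial (Fin n) K := term s (coeff s.1 (u s.2)) +
    ∑ q ∈ (freeSupport u).erase s, (C (coeff q.1 (u q.2)) : MvPolynomial (Fin n) K) • r q with hu'
  have hlt : ∀ q ∈ (freeSupport u).erase s, key' q < key' s := by
    intro q hq
    rw [Finset.mem_erase, mem_freeSupport] at hq
    exact hus.2 q hq.2 hq.1
  have hu'N : u' ∈ N := by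
    have : u - u' = ∑ q ∈ (freeSupport u).erase s,
        (C (coeff q.1 (u q.2)) : MvPolynomial (Fin n) K) • (term q 1 - r q) := by
      rw [hu']
      conv_lhs => enter [1]; rw [← sum_term u]
      rw [← Finset.add_sum_erase _ _ (mem_freeSupport.2 hus.1)]
      simp only [smul_sub, Finset.sum_sub_distrib]
      have : ∀ q : (Fin n →₀ ℕ) × Fin m,
          (C (coeff q.1 (u q.2)) : MvPolynomial (Fin n) K) • term q 1 =
            term q (coeff q.1 (u q.2)) := by
        intro q
        rw [C_apply, monomial_smul_term, add_zero, mul_one]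
      simp only [this]
      abel
    have h2 : u - u' ∈ N := by
      rw [this]
      exact N.sum_mem fun q _ => N.smul_mem _ (hrN q)
    exact (N.sub_mem_iff_right hu).1 h2
  have hcoeff : coeff s.1 (u' s.2) = coeff s.1 (u s.2) := by
    rw [hu', Pi.add_apply, coeff_add, coeff_term, if_pos rfl, Finset.sum_apply, coeff_sum,
      Finset.sum_eq_zero, add_zero]
    intro q hq
    rw [coeff_C_smul]
    by_contra hne
    exact absurd (hr q s (right_ne_zero_of_mul hne)).1 (not_le.2 (hlt q hq))
  have hne : u' ≠ 0 := by
    intro h0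
    rw [h0] at hcoeff
    exact hus.1 (by simpa using hcoeff.symm)
  obtain ⟨p, hp⟩ := exists_isLead hkey hne
  have hpT : p ∈ T := ⟨u', hu'N, hp⟩
  by_cases h1 : s = p
  · exact hs (h1 ▸ hpT)
  · have h2 := hp.1
    rw [hu', Pi.add_apply, coeff_add, coeff_term, if_neg h1, zero_add, Finset.sum_apply,
      coeff_sum] at h2
    obtain ⟨q, hq, hne⟩ := Finset.exists_ne_zero_of_sum_ne_zero h2
    rw [coeff_C_smul] at hne
    exact (hr q p (right_ne_zero_of_mul hne)).2 hpT

end NormalForm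

/-! ### Weights that are compatible with a Gröbner basis of the syzygy module -/

section Compatible

variable {K : Type u} [Field K] {n m : ℕ} {ord : MonomialOrder.{0, v} (Fin n)}
  {F : Fin m → MvPolynomial (Fin n) K} {ω : Fin n → ℕ}

theorem le_wdeg {u : Fin m → MvPolynomial (Fin n) K} {p : (Fin n →₀ ℕ) × Fin m}
    (hp : coeff p.1 (u p.2) ≠ 0) : wdegMon F ω p.1 p.2 ≤ wdeg F ω u :=
  (Finset.le_sup (f := fun α => wdegMon F ω α p.2) (mem_support_iff.2 hp)).trans
    (Finset.le_sup (f := fun i => (u i).support.sup fun α => wdegMon F ω α i)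
      (Finset.mem_univ p.2))

theorem topTerms_eq (u : Fin m → MvPolynomial (Fin n) K) :
    topTerms F ω u = degreePart ω F (wdeg F ω u) u := rfl

theorem sum_degreePart (v : Fin m → MvPolynomial (Fin n) K) :
    ∑ D ∈ Finset.range (wdeg F ω v + 1), degreePart ω F D v = v := by
  refine free_ext fun s => ?_
  rw [Finset.sum_apply, coeff_sum]
  simp only [coeff_degreePart]
  rw [Finset.sum_ite_eq]
  split_ifs with h
  · rfl
  · by_contra h0
    exact h (Finset.mem_range.2 (Nat.lt_succ_of_le (le_wdeg (Ne.symm h0))))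

/-- Each degree part of an element of im φ is the degree part of a syzygy in a degree that bounds
it. -/
theorem span_topTerms : Submodule.span (MvPolynomial (Fin n) K)
    (topTerms F ω '' (Syz F : Set (Fin m → MvPolynomial (Fin n) K))) = imPhi ω F := by
  apply le_antisymm
  · rw [Submodule.span_le]
    rintro _ ⟨u, hu, rfl⟩
    exact degreePart_mem_imPhi hu fun p hp => le_wdeg hp
  · intro v hv
    rw [← sum_degreePart (F := F) (ω := ω) v]
    refine Submodule.sum_mem _ fun D _ => ?_
    obtain ⟨u, hu, hle, hpart⟩ := exists_syzygy_of_mem_imPhi hv D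
    rw [← hpart]
    -- If this part is non-zero, `D` is the true ω-degree of `u` and the part is its top form.
    by_cases h0 : degreePart ω F D u = 0
    · rw [h0]
      exact Submodule.zero_mem _
    · obtain ⟨s, hs⟩ := exists_coeff_ne_zero h0
      rw [coeff_degreePart] at hs
      have hsD : wdegMon F ω s.1 s.2 = D := by
        by_contra h
        exact hs (if_neg h)
      rw [if_pos hsD] at hs
      have hw : wdeg F ω u = D := by
        apply le_antisymm
        · refine Finset.sup_le fun i _ => Finset.sup_le fun α hα => ?_
          exact hle (α, i) (mem_support_iff.1 hα)
        · rw [← hsD]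
          exact le_wdeg hs
      refine Submodule.subset_span ⟨u, hu, ?_⟩
      rw [topTerms_eq, hw]

/-- The key of the order that compares the `ω`-degree first, and uses the Schreyer order to break
ties. -/
def weightKey (ord : MonomialOrder.{0, v} (Fin n)) (F : Fin m → MvPolynomial (Fin n) K)
    (ω : Fin n → ℕ) (s : (Fin n →₀ ℕ) × Fin m) : ℕ ×ₗ (ord.syn ×ₗ Fin m) :=
  toLex (wdegMon F ω s.1 s.2, schreyerKey ord F s)

theorem weightKey_lt_iff {s s' : (Fin n →₀ ℕ) × Fin m} :
    weightKey ord F ω s < weightKey ord F ω s' ↔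
      wdegMon F ω s.1 s.2 < wdegMon F ω s'.1 s'.2 ∨
        (wdegMon F ω s.1 s.2 = wdegMon F ω s'.1 s'.2 ∧
          schreyerKey ord F s < schreyerKey ord F s') := by
  rw [weightKey, weightKey, Prod.Lex.toLex_lt_toLex]

theorem isTermKey_weightKey : IsTermKey (weightKey ord F ω) where
  injective := fun s s' h =>
    (isTermKey_schreyerKey ord F).injective (Prod.ext_iff.1 (toLex.injective h)).2
  shift := by
    intro s s' δ h
    rw [weightKey_lt_iff] at h ⊢
    have hshift : ∀ p : (Fin n →₀ ℕ) × Fin m,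
        wdegMon F ω (p.1 + δ) p.2 = wdegMon F ω p.1 p.2 + Finsupp.weight ω δ := by
      intro p
      rw [wdegMon, wdegMon, map_add]
      ring
    simp only [hshift, add_lt_add_iff_right, add_left_inj]
    rcases h with h | h
    · exact Or.inl h
    · exact Or.inr ⟨h.1, (isTermKey_schreyerKey ord F).shift _ _ δ h.2⟩

theorem IsCompatible.mono {A B : Set (Fin n →₀ ℕ)} (h : IsCompatible ord ω B) (hAB : A ⊆ B) :
    IsCompatible ord ω A :=
  ⟨h.1, fun α hα β hβ => h.2 α (hAB hα) β (hAB hβ)⟩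

variable {V : Finset (Fin m → MvPolynomial (Fin n) K)}

theorem exists_isLead_of_mem_LS (hV : IsModuleGroebner ord F V (Syz F))
    {s : (Fin n →₀ ℕ) × Fin m} (hs : s ∈ LS ord F) :
    ∃ v ∈ V, ∃ t, IsLead (schreyerKey ord F) v t ∧ ∃ δ, s = (t.1 + δ, t.2) := by
  have h := term_mem_monSpan (K := K) hs
  rw [LS, hV.2] at h
  obtain ⟨t, ht, δ, hδ⟩ := exists_of_term_mem_monSpan h
  obtain ⟨v, hv, hvt⟩ := (mem_LMset ord F).1 ht
  exact ⟨v, hv, t, hvt, δ, hδ⟩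

theorem IsModuleGroebner.subset (hV : IsModuleGroebner ord F V (Syz F)) {v} (hv : v ∈ V) :
    v ∈ Syz F := by
  rw [← hV.1]
  exact Submodule.subset_span hv

/-- By compatibility, a monomial of larger ω-degree would also have larger multidegree, against the
Schreyer order. -/
theorem wdegMon_le_of_isLead (hF : ∀ i, F i ≠ 0) (hω : IsWeightLeading ord F ω)
    (hc : IsCompatible ord ω (shiftedMonomialsOf ord F V)) {v : Fin m → MvPolynomial (Fin n) K}
    (hv : v ∈ V) {t p : (Fin n →₀ ℕ) × Fin m} (ht : IsLead (schreyerKey ord F) v t)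
    (hp : coeff p.1 (v p.2) ≠ 0) : wdegMon F ω p.1 p.2 ≤ wdegMon F ω t.1 t.2 := by
  rw [hω.wdegMon_eq hF, hω.wdegMon_eq hF]
  by_contra! h
  rw [← hc.2 _ ⟨v, hv, t.2, t.1, mem_support_iff.2 ht.1, rfl⟩ _
    ⟨v, hv, p.2, p.1, mem_support_iff.2 hp, rfl⟩] at h
  exact absurd (toSyn_le_of_isLead ht hp) (not_le.2 h)

theorem LS_subset_LImS (hF : ∀ i, F i ≠ 0) (hω : IsWeightLeading ord F ω)
    (hV : IsModuleGroebner ord F V (Syz F))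
    (hc : IsCompatible ord ω (shiftedMonomialsOf ord F V)) : LS ord F ⊆ LImS ord ω F := by
  intro s hs
  obtain ⟨v, hv, t, ht, δ, rfl⟩ := exists_isLead_of_mem_LS hV hs
  refine isMonomialClosed_LImS t ?_ δ
  rw [LImS_eq, mem_LMset]
  exact ⟨_, degreePart_mem_imPhi (hV.subset hv)
    fun p hp => wdegMon_le_of_isLead hF hω hc hv ht hp, isLead_degreePart ht⟩

/-- Passing to the top terms does not enlarge the initial module when `ω` is compatible with a
Gröbner basis of the syzygies; so `M(F)` vanishes, which is why the sequence splits. -/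
theorem LImS_subset_LS (hF : ∀ i, F i ≠ 0) (hω : IsWeightLeading ord F ω)
    (hV : IsModuleGroebner ord F V (Syz F))
    (hc : IsCompatible ord ω (shiftedMonomialsOf ord F V)) : LImS ord ω F ⊆ LS ord F := by
  intro s hs
  rw [LImS_eq, mem_LMset] at hs
  obtain ⟨v, hv, hvs⟩ := hs
  obtain ⟨u, hu, hle, hpart⟩ := exists_syzygy_of_mem_imPhi hv (wdegMon F ω s.1 s.2)
  have hlead := isLead_degreePart (ω := ω) (F := F) hvs
  rw [← hpart] at hlead
  -- `u` has no term above the degree of `s`, and its part in that degree is led by `s`.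
  have hus : IsLead (weightKey ord F ω) u s := by
    refine ⟨?_, fun p hp hne => ?_⟩
    · have := hlead.1
      rwa [coeff_degreePart, if_pos rfl] at this
    · rw [weightKey_lt_iff]
      rcases (hle p hp).lt_or_eq with h | h
      · exact Or.inl h
      · exact Or.inr ⟨h, hlead.2 p (by rwa [coeff_degreePart, if_pos h]) hne⟩
  rw [LS, mem_LMset]
  refine exists_isLead_of_isLead (isTermKey_schreyerKey ord F) (fun p hp => ?_) hu hus
  -- Every Schreyer-leading monomial of Syz(F) is a multiple of one from `V`, and on `V` both orders
  -- select the same monomial.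
  obtain ⟨w, hw, t, ht, δ, rfl⟩ := exists_isLead_of_mem_LS hV ((mem_LMset ord F).2 hp)
  have ht' : IsLead (weightKey ord F ω) w t := by
    refine ⟨ht.1, fun q hq hne => ?_⟩
    rw [weightKey_lt_iff]
    rcases (wdegMon_le_of_isLead hF hω hc hw ht hq).lt_or_eq with h | h
    · exact Or.inl h
    · exact Or.inr ⟨h, ht.2 q hq hne⟩
  exact ⟨_, Submodule.smul_mem _ (monomial δ 1) (hV.subset hw),
    ht'.monomial_smul isTermKey_weightKey δ one_ne_zero⟩

/-- The exact sequence of monomial quotients splits if its first term vanishes. -/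
theorem exists_splitting {T T' T'' : Set ((Fin n →₀ ℕ) × Fin m)} (h : T' = T'') :
    ∃ e : MonQuot K T T'' ≃ₗ[MvPolynomial (Fin n) K] (MonQuot K T' T'' × MonQuot K T T'),
      (∀ (w : Fin m → MvPolynomial (Fin n) K) (hw : w ∈ monSpan K T) (hw' : w ∈ monSpan K T'),
        e (MonQuot.mk T'' w hw) = (MonQuot.mk T'' w hw', 0)) ∧
      (∀ (w : Fin m → MvPolynomial (Fin n) K) (hw : w ∈ monSpan K T),
        (e (MonQuot.mk T'' w hw)).2 = MonQuot.mk T' w hw) := by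
  subst h
  have hsub : Subsingleton (MonQuot K T' T') := by
    rw [Submodule.Quotient.subsingleton_iff, Submodule.submoduleOf_self]
  have : Unique (MonQuot K T' T') := Unique.mk' _
  refine ⟨(LinearEquiv.uniqueProd (R := MvPolynomial (Fin n) K) (M := MonQuot K T T')
    (M₂ := MonQuot K T' T')).symm, fun w hw hw' => Prod.ext (Subsingleton.elim _ _) ?_,
    fun w hw => rfl⟩
  change MonQuot.mk T' w hw = 0
  exact (Submodule.Quotient.mk_eq_zero _).2 hw'

end Compatible

/-! ### Existence of Gröbner bases of syzygies and of compatible weights -/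

section Existence

/-- By noetherianity, finitely many leading monomials suffice. Elements realizing them are joined
with generators of `N`. -/
theorem exists_isModuleGroebner {K : Type u} [Field K] {n m : ℕ}
    (ord : MonomialOrder.{0, v} (Fin n)) (F : Fin m → MvPolynomial (Fin n) K)
    (N : Submodule (MvPolynomial (Fin n) K) (Fin m → MvPolynomial (Fin n) K)) :
    ∃ V : Finset (Fin m → MvPolynomial (Fin n) K), IsModuleGroebner ord F V N := by
  classical
  set T := LMset ord F (N : Set (Fin m → MvPolynomial (Fin n) K)) with hT
  obtain ⟨G, hG⟩ : N.FG := IsNoetherian.noetherian N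
  have hfg : (monSpan K T).FG := IsNoetherian.noetherian _
  rw [monSpan, Submodule.fg_span_iff_fg_span_finset_subset] at hfg
  obtain ⟨S, hS, hspan⟩ := hfg
  obtain ⟨T₀, hT₀, rfl⟩ := Finset.subset_set_image_iff.1 hS
  have hex : ∀ t : (Fin n →₀ ℕ) × Fin m, ∃ u : Fin m → MvPolynomial (Fin n) K,
      t ∈ T → u ∈ N ∧ IsLeadMon ord F u t := by
    intro t
    by_cases ht : t ∈ T
    · obtain ⟨u, hu, hut⟩ := ht
      exact ⟨u, fun _ => ⟨hu, hut⟩⟩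
    · exact ⟨0, fun h => absurd h ht⟩
  choose w hw using hex
  have hVN : ((G ∪ T₀.image w : Finset _) : Set (Fin m → MvPolynomial (Fin n) K)) ⊆ N := by
    intro x hx
    rw [Finset.mem_coe, Finset.mem_union, Finset.mem_image] at hx
    rcases hx with hx | ⟨t, ht, rfl⟩
    · rw [← hG]
      exact Submodule.subset_span hx
    · exact (hw t (hT₀ ht)).1
  refine ⟨G ∪ T₀.image w, le_antisymm (Submodule.span_le.2 hVN) ?_,
    le_antisymm ?_ (monSpan_mono (LMset_mono ord F hVN))⟩
  · conv_lhs => rw [← hG]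
    exact Submodule.span_mono (by simp)
  · rw [monSpan, hspan, Submodule.span_le]
    intro x hx
    rw [Finset.coe_image] at hx
    obtain ⟨t, ht, rfl⟩ := hx
    refine Submodule.subset_span ⟨t, ⟨w t, ?_, (hw t (hT₀ ht)).2⟩, rfl⟩
    rw [Finset.mem_coe, Finset.mem_union, Finset.mem_image]
    exact Or.inr ⟨t, ht, rfl⟩

/-- Finitely many vectors from a set that is closed under addition and does not contain `0` lie
strictly on one side of a rational hyperplane. -/
theorem exists_rat_weight_pos {n : ℕ} {P : (Fin n → ℤ) → Prop}
    (hadd : ∀ x y, P x → P y → P (x + y)) (h0 : ¬ P 0) (D : Finset (Fin n → ℤ))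
    (hD : ∀ x ∈ D, P x) : ∃ ω : Fin n → ℚ, ∀ x ∈ D, 0 < ∑ k, ω k * x k := by
  classical
  induction n with
  | zero => exact ⟨0, fun x hx => absurd (Subsingleton.elim x 0 ▸ hD x hx) h0⟩
  | succ n ih =>
    have hsmul : ∀ (a : ℤ) (x : Fin (n + 1) → ℤ), 0 < a → P x → P (a • x) := by
      intro a x ha hx
      obtain ⟨b, rfl⟩ : ∃ b : ℕ, a = b + 1 := ⟨(a - 1).toNat, by omega⟩
      induction b with
      | zero => simpa using hx
      | succ b ihb =>
        have := hadd _ _ (ihb (by positivity)) hx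
        rw [← add_one_zsmul] at this
        exact_mod_cast this
    set pos := D.filter fun x => 0 < x 0 with hpos
    set neg := D.filter fun x => x 0 < 0 with hneg
    set zer := D.filter fun x => x 0 = 0 with hzer
    -- Fourier–Motzkin elimination of coordinate 0: the vectors already in the hyperplane, and for
    -- each pair of opposite signs the positive combination that falls into it.
    set E : Finset (Fin (n + 1) → ℤ) :=
      zer ∪ (pos ×ˢ neg).image fun x => x.1 0 • x.2 + (-x.2 0) • x.1 with hE
    have hE0 : ∀ x ∈ E, x 0 = 0 ∧ P x := by
      intro x hx
      simp only [hE, hzer, hpos, hneg, Finset.mem_union, Finset.mem_image, Finset.mem_filter,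
        Finset.mem_product, Prod.exists] at hx
      rcases hx with ⟨hx, hx0⟩ | ⟨y, z, ⟨⟨hy, hy0⟩, hz, hz0⟩, rfl⟩
      · exact ⟨hx0, hD x hx⟩
      · refine ⟨?_, hadd _ _ (hsmul _ _ hy0 (hD z hz)) (hsmul _ _ (by omega) (hD y hy))⟩
        simp only [Pi.add_apply, Pi.smul_apply, smul_eq_mul]
        ring
    obtain ⟨ω, hω⟩ := ih (P := fun x => P (Fin.cons 0 x : Fin (n + 1) → ℤ))
      (fun x y hx hy => by
        have := hadd _ _ hx hy
        convert this using 1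
        ext k
        refine Fin.cases ?_ (fun k => ?_) k <;> simp)
      (by
        convert h0 using 2
        ext k
        refine Fin.cases ?_ (fun k => ?_) k <;> simp)
      (E.image Fin.tail) (by
        intro x hx
        obtain ⟨y, hy, rfl⟩ := Finset.mem_image.1 hx
        have : (Fin.cons 0 (Fin.tail y) : Fin (n + 1) → ℤ) = y := by
          rw [← (hE0 y hy).1, Fin.cons_self_tail]
        rw [this]
        exact (hE0 y hy).2)
    set φ : (Fin (n + 1) → ℤ) → ℚ := fun x => ∑ k, ω k * (Fin.tail x k : ℤ) with hφ
    have hφE : ∀ x ∈ E, 0 < φ x := fun x hx => hω _ (Finset.mem_image_of_mem _ hx)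
    -- The weight `c` of coordinate 0 is bounded below by `pos` and above by `neg`; positivity on
    -- the combined vectors of `E` puts every lower bound below every upper bound.
    obtain ⟨c, hlo, hhi⟩ := Order.exists_between_finsets
      (pos.image fun x => -φ x / (x 0 : ℚ)) (neg.image fun x => φ x / -(x 0 : ℚ)) (by
        intro a ha b hb
        obtain ⟨y, hy, rfl⟩ := Finset.mem_image.1 ha
        obtain ⟨z, hz, rfl⟩ := Finset.mem_image.1 hb
        have hyz := hφE (y 0 • z + (-z 0) • y) (by
          rw [hE, Finset.mem_union]
          exact Or.inr (Finset.mem_image.2 ⟨(y, z), Finset.mem_product.2 ⟨hy, hz⟩, rfl⟩))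
        have hy0 : (0 : ℚ) < y 0 := by exact_mod_cast (Finset.mem_filter.1 hy).2
        have hz0 : (z 0 : ℚ) < 0 := by exact_mod_cast (Finset.mem_filter.1 hz).2
        have hlin : φ (y 0 • z + (-z 0) • y) = y 0 * φ z + -(z 0 : ℚ) * φ y := by
          simp only [hφ, Fin.tail, Pi.add_apply, Pi.smul_apply, smul_eq_mul, Finset.mul_sum,
            ← Finset.sum_add_distrib]
          refine Finset.sum_congr rfl fun k _ => ?_
          push_cast
          ring
        rw [hlin] at hyz
        rw [div_lt_div_iff₀ hy0 (by linarith)]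
        linarith)
    refine ⟨Fin.cons c ω, fun x hx => ?_⟩
    have hsum : ∑ k, (Fin.cons c ω : Fin (n + 1) → ℚ) k * x k = c * x 0 + φ x := by
      rw [Fin.sum_univ_succ]
      rfl
    rw [hsum]
    rcases lt_trichotomy (x 0) 0 with h | h | h
    · have h1 := hhi _ (Finset.mem_image_of_mem _ (Finset.mem_filter.2 ⟨hx, h⟩))
      have h2 : (x 0 : ℚ) < 0 := by exact_mod_cast h
      rw [lt_div_iff₀ (by linarith)] at h1
      linarith
    · rw [h, Int.cast_zero, mul_zero, zero_add]
      refine hφE x ?_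
      rw [hE, Finset.mem_union]
      exact Or.inl (Finset.mem_filter.2 ⟨hx, h⟩)
    · have h1 := hlo _ (Finset.mem_image_of_mem _ (Finset.mem_filter.2 ⟨hx, h⟩))
      have h2 : (0 : ℚ) < x 0 := by exact_mod_cast h
      rw [div_lt_iff₀ h2] at h1
      linarith

theorem exists_nat_mul_eq {n : ℕ} (ω : Fin n → ℚ) (hω : ∀ k, 0 ≤ ω k) :
    ∃ (N : ℕ) (a : Fin n → ℕ), 0 < N ∧ ∀ k, (a k : ℚ) = N * ω k := by
  have hdvd : ∀ k, ∃ M, ∏ j, (ω j).den = (ω k).den * M := fun k =>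
    Finset.dvd_prod_of_mem _ (Finset.mem_univ k)
  choose M hM using hdvd
  refine ⟨∏ j, (ω j).den, fun k => M k * (ω k).num.toNat,
    Finset.prod_pos fun j _ => (ω j).den_pos, fun k => ?_⟩
  have h1 : (((ω k).num.toNat : ℤ) : ℚ) = (ω k).num := by
    rw [Int.toNat_of_nonneg (Rat.num_nonneg.2 (hω k))]
  have h2 : ((ω k).den : ℚ) * ω k = (ω k).num := Rat.den_mul_eq_num _
  rw [hM k]
  push_cast at h1 ⊢
  rw [h1, ← h2]
  ring

/-- Differences of strictly ordered exponents are closed under addition and never 0, so a rational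
weight is positive on any finite set of them; clearing denominators makes it integral. -/
theorem exists_isCompatible {n : ℕ} (ord : MonomialOrder.{0, v} (Fin n))
    {A : Set (Fin n →₀ ℕ)} (hA : A.Finite) : ∃ ω, IsCompatible ord ω A := by
  classical
  lift A to Finset (Fin n →₀ ℕ) using hA
  set d : (Fin n →₀ ℕ) × (Fin n →₀ ℕ) → Fin n → ℤ := fun x k => (x.2 k : ℤ) - x.1 k with hd
  -- The pairs of 1 and a variable force the weight to be positive.
  set pairs := ((A ×ˢ A).filter fun x => ord.toSyn x.1 < ord.toSyn x.2) ∪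
    Finset.univ.image fun k : Fin n => (0, Finsupp.single k 1) with hpairs
  have hlt : ∀ x ∈ pairs, ord.toSyn x.1 < ord.toSyn x.2 := by
    intro x hx
    rw [hpairs, Finset.mem_union, Finset.mem_filter, Finset.mem_image] at hx
    rcases hx with hx | ⟨k, -, rfl⟩
    · exact hx.2
    · rw [map_zero, ord.toSyn_lt_iff_ne_zero, Ne, ord.toSyn_eq_zero_iff]
      simp
  obtain ⟨ω, hω⟩ := exists_rat_weight_pos
    (P := fun x => ∃ y : (Fin n →₀ ℕ) × (Fin n →₀ ℕ), ord.toSyn y.1 < ord.toSyn y.2 ∧ d y = x)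
    (by
      rintro _ _ ⟨y, hy, rfl⟩ ⟨z, hz, rfl⟩
      refine ⟨y + z, ?_, ?_⟩
      · rw [Prod.fst_add, Prod.snd_add, map_add, map_add]
        exact add_lt_add hy hz
      · ext k
        simp only [hd, Prod.fst_add, Prod.snd_add, Finsupp.add_apply, Pi.add_apply]
        push_cast
        ring)
    (by
      rintro ⟨y, hy, h0⟩
      have : y.1 = y.2 := by
        ext k
        have := congrFun h0 k
        simp only [hd, Pi.zero_apply] at this
        omega
      rw [this] at hy
      exact lt_irrefl _ hy)
    (pairs.image d) (by
      intro x hx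
      obtain ⟨y, hy, rfl⟩ := Finset.mem_image.1 hx
      exact ⟨y, hlt y hy, rfl⟩)
  have hωpos : ∀ k, 0 < ω k := by
    intro k
    have := hω (d (0, Finsupp.single k 1)) (Finset.mem_image_of_mem _ (by
      rw [hpairs, Finset.mem_union]
      exact Or.inr (Finset.mem_image_of_mem _ (Finset.mem_univ k))))
    simpa [hd, Finsupp.single_apply] using this
  obtain ⟨N, a, hN, ha⟩ := exists_nat_mul_eq ω fun k => (hωpos k).le
  have hN' : (0 : ℚ) < N := by exact_mod_cast hN
  have hweight : ∀ α : Fin n →₀ ℕ, ((Finsupp.weight a α : ℕ) : ℚ) = N * ∑ k, ω k * α k := by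
    intro α
    rw [Finsupp.weight_apply, Finsupp.sum_fintype _ _ (by simp), Finset.mul_sum]
    push_cast
    refine Finset.sum_congr rfl fun k _ => ?_
    rw [smul_eq_mul, Nat.cast_mul, ha]
    ring
  have hmono : ∀ α ∈ A, ∀ β ∈ A, ord.toSyn α < ord.toSyn β →
      Finsupp.weight a α < Finsupp.weight a β := by
    intro α hα β hβ h
    have := hω (d (α, β)) (Finset.mem_image_of_mem _ (by
      rw [hpairs, Finset.mem_union, Finset.mem_filter, Finset.mem_product]
      exact Or.inl ⟨⟨hα, hβ⟩, h⟩))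
    simp only [hd] at this
    push_cast at this
    simp only [mul_sub, Finset.sum_sub_distrib, sub_pos] at this
    have h2 : ((Finsupp.weight a α : ℕ) : ℚ) < (Finsupp.weight a β : ℕ) := by
      rw [hweight, hweight]
      exact mul_lt_mul_of_pos_left this hN'
    exact_mod_cast h2
  refine ⟨a, fun k => ?_, fun α hα β hβ => ⟨hmono α hα β hβ, fun h => ?_⟩⟩
  · have h1 : (0 : ℚ) < a k := by
      rw [ha]
      exact mul_pos hN' (hωpos k)
    exact_mod_cast h1
  · by_contra! h'
    rcases h'.lt_or_eq with h2 | h2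
    · exact lt_asymm h (hmono β hβ α hα h2)
    · rw [ord.toSyn.injective h2] at h
      exact lt_irrefl _ h

theorem finite_monomialsOf_union {K : Type u} [Field K] {n m : ℕ}
    (ord : MonomialOrder.{0, v} (Fin n)) (F : Fin m → MvPolynomial (Fin n) K)
    (V : Finset (Fin m → MvPolynomial (Fin n) K)) :
    (monomialsOf F ∪ shiftedMonomialsOf ord F V).Finite := by
  refine Set.Finite.union ?_ ?_
  · refine (Set.finite_iUnion fun i : Fin m => (F i).support.finite_toSet).subset ?_
    rintro α ⟨i, hi⟩
    exact Set.mem_iUnion.2 ⟨i, hi⟩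
  · refine (Set.Finite.biUnion V.finite_toSet fun w _ => Set.finite_iUnion fun i : Fin m =>
      ((w i).support.finite_toSet.image fun α => α + ord.degree (F i))).subset ?_
    rintro β ⟨w, hw, i, α, hα, rfl⟩
    exact Set.mem_biUnion hw (Set.mem_iUnion.2 ⟨i, α, hα, rfl⟩)

end Existence

/-! ### The fibres of the family -/

section Fibres

theorem map_idealOf {A B : Type u} [CommRing A] [CommRing B] {m : ℕ} (f : A →+* B) (F : Fin m → A) :
    (idealOf F).map f = idealOf fun i => f (F i) := by
  rw [idealOf, Ideal.map_span, ← Set.range_comp]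
  rfl

theorem idealOf_eq_of_associated {A : Type u} [CommRing A] {m : ℕ} {F G : Fin m → A}
    (h : ∀ i, Associated (F i) (G i)) : idealOf F = idealOf G := by
  apply le_antisymm
  · rw [idealOf, Ideal.span_le]
    rintro _ ⟨i, rfl⟩
    exact Ideal.mem_of_dvd _ (h i).symm.dvd (Ideal.subset_span ⟨i, rfl⟩)
  · rw [idealOf, Ideal.span_le]
    rintro _ ⟨i, rfl⟩
    exact Ideal.mem_of_dvd _ (h i).dvd (Ideal.subset_span ⟨i, rfl⟩)

theorem eval₂Hom_map_eq {S T A : Type u} [CommRing S] [CommRing T] [CommRing A] {n : ℕ}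
    {φ : S →+* T} {J : Ideal (MvPolynomial (Fin n) S)} (f : MvPolynomial (Fin n) S ⧸ J →+* A)
    (g : T →+* A) (h : ∀ s, f (Ideal.Quotient.mk J (C s)) = g (φ s))
    (p : MvPolynomial (Fin n) S) :
    eval₂Hom g (fun k => f (Ideal.Quotient.mk J (X k))) (MvPolynomial.map φ p) =
      f (Ideal.Quotient.mk J p) := by
  have : (eval₂Hom g fun k => f (Ideal.Quotient.mk J (X k))).comp (MvPolynomial.map φ) =
      f.comp (Ideal.Quotient.mk J) := by
    apply MvPolynomial.ringHom_ext
    · intro s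
      simp [h]
    · intro k
      simp
  exact RingHom.congr_fun this p

/-- The universal property of the base change of a quotient of a polynomial ring. -/
def quotientDesc {S T A : Type u} [CommRing S] [CommRing T] [CommRing A] {n : ℕ}
    {φ : S →+* T} {J : Ideal (MvPolynomial (Fin n) S)} (f : MvPolynomial (Fin n) S ⧸ J →+* A)
    (g : T →+* A) (h : ∀ s, f (Ideal.Quotient.mk J (C s)) = g (φ s)) :
    MvPolynomial (Fin n) T ⧸ J.map (MvPolynomial.map φ) →+* A :=
  Ideal.Quotient.lift _ (eval₂Hom g fun k => f (Ideal.Quotient.mk J (X k))) (by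
    suffices hle : J.map (MvPolynomial.map φ) ≤
        RingHom.ker (eval₂Hom g fun k => f (Ideal.Quotient.mk J (X k))) from fun a ha => hle ha
    rw [Ideal.map_le_iff_le_comap]
    intro p hp
    rw [Ideal.mem_comap, RingHom.mem_ker, eval₂Hom_map_eq f g h,
      Ideal.Quotient.eq_zero_iff_mem.2 hp, map_zero])

/-- Base change of a quotient of a polynomial ring. -/
theorem isPushout_quotient {S T : Type u} [CommRing S] [CommRing T] {n : ℕ} (φ : S →+* T)
    (J : Ideal (MvPolynomial (Fin n) S)) :
    IsPushout (CommRingCat.ofHom (algebraMap S (MvPolynomial (Fin n) S ⧸ J)))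
      (CommRingCat.ofHom φ)
      (CommRingCat.ofHom (Ideal.quotientMap (J.map (MvPolynomial.map φ)) (MvPolynomial.map φ)
        Ideal.le_comap_map))
      (CommRingCat.ofHom (algebraMap T (MvPolynomial (Fin n) T ⧸ J.map (MvPolynomial.map φ)))) := by
  have w : CommRingCat.ofHom (algebraMap S (MvPolynomial (Fin n) S ⧸ J)) ≫
      CommRingCat.ofHom (Ideal.quotientMap (J.map (MvPolynomial.map φ)) (MvPolynomial.map φ)
        Ideal.le_comap_map) = CommRingCat.ofHom φ ≫ CommRingCat.ofHom
          (algebraMap T (MvPolynomial (Fin n) T ⧸ J.map (MvPolynomial.map φ))) := by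
    ext s
    change Ideal.Quotient.mk (J.map (MvPolynomial.map φ)) (MvPolynomial.map φ (C s)) =
      Ideal.Quotient.mk (J.map (MvPolynomial.map φ)) (C (φ s))
    rw [map_C]
  have hc : ∀ (c : PushoutCocone (CommRingCat.ofHom (algebraMap S (MvPolynomial (Fin n) S ⧸ J)))
      (CommRingCat.ofHom φ)) (s : S),
      c.inl.hom (Ideal.Quotient.mk J (C s)) = c.inr.hom (φ s) := fun c s =>
    RingHom.congr_fun (congrArg CommRingCat.Hom.hom c.condition) s
  refine ⟨⟨w⟩, ⟨PushoutCocone.IsColimit.mk w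
    (fun c => CommRingCat.ofHom (quotientDesc c.inl.hom c.inr.hom (hc c))) ?_ ?_ ?_⟩⟩
  · intro c
    refine CommRingCat.hom_ext (RingHom.ext fun x => ?_)
    obtain ⟨p, rfl⟩ := Ideal.Quotient.mk_surjective x
    exact eval₂Hom_map_eq c.inl.hom c.inr.hom (hc c) p
  · intro c
    ext t
    exact eval₂Hom_C _ _ t
  · intro c l h1 h2
    refine CommRingCat.hom_ext (RingHom.ext fun x => ?_)
    obtain ⟨p, rfl⟩ := Ideal.Quotient.mk_surjective x
    have : l.hom.comp (Ideal.Quotient.mk (J.map (MvPolynomial.map φ))) =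
        eval₂Hom c.inr.hom fun k => c.inl.hom (Ideal.Quotient.mk J (X k)) := by
      apply MvPolynomial.ringHom_ext
      · intro t
        rw [eval₂Hom_C]
        exact RingHom.congr_fun (congrArg CommRingCat.Hom.hom h2) t
      · intro k
        rw [eval₂Hom_X']
        have := RingHom.congr_fun (congrArg CommRingCat.Hom.hom h1) (Ideal.Quotient.mk J (X k))
        rw [← this]
        change l.hom _ = l.hom (Ideal.Quotient.mk (J.map (MvPolynomial.map φ))
          (MvPolynomial.map φ (X k)))
        rw [map_X]
    exact RingHom.congr_fun this p

theorem nonempty_pullback_iso_specOver {S L : Type u} [CommRing S] [Field L] {n : ℕ} (φ : S →+* L)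
    (J : Ideal (MvPolynomial (Fin n) S)) :
    Nonempty (Over.mk (pullback.snd
      (Spec.map (CommRingCat.ofHom (algebraMap S (MvPolynomial (Fin n) S ⧸ J))))
      (Spec.map (CommRingCat.ofHom φ))) ≅ specOver (J.map (MvPolynomial.map φ))) := by
  have h := isPullback_SpecMap_of_isPushout _ _ _ _ (isPushout_quotient φ J)
  exact ⟨(Over.isoMk h.isoPullback h.isoPullback_hom_snd).symm⟩

theorem nonempty_specOver_iso {L : Type u} [Field L] {n : ℕ}
    (σ : MvPolynomial (Fin n) L ≃ₐ[L] MvPolynomial (Fin n) L)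
    {I J : Ideal (MvPolynomial (Fin n) L)} (h : J = I.map (σ : MvPolynomial (Fin n) L →+* _)) :
    Nonempty (specOver I ≅ specOver J) := by
  let e := Ideal.quotientEquivAlg I J σ h
  refine ⟨(Over.isoMk (Scheme.Spec.mapIso e.toRingEquiv.toCommRingCatIso.op) ?_).symm⟩
  change Spec.map (CommRingCat.ofHom e.toRingEquiv.toRingHom) ≫ Spec.map _ = Spec.map _
  rw [← Spec.map_comp, ← CommRingCat.ofHom_comp]
  congr 2
  exact e.toAlgHom.comp_algebraMap

theorem scaleVars_comp {L : Type u} [Field L] {n : ℕ} (ω : Fin n → ℕ) {a b : L} (hab : a * b = 1) :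
    (scaleVars ω a).comp (scaleVars ω b) = AlgHom.id L (MvPolynomial (Fin n) L) := by
  ext1 k
  rw [AlgHom.comp_apply, AlgHom.id_apply]
  ext1 γ
  rw [coeff_scaleVars, coeff_scaleVars, mul_assoc, ← mul_pow, mul_comm b, hab, one_pow, mul_one]

/-- The automorphism `x_k ↦ a^(ω_k) x_k`. -/
def scaleEquiv {L : Type u} [Field L] {n : ℕ} (ω : Fin n → ℕ) {a : L} (ha : a ≠ 0) :
    MvPolynomial (Fin n) L ≃ₐ[L] MvPolynomial (Fin n) L :=
  AlgEquiv.ofAlgHom (scaleVars ω a) (scaleVars ω a⁻¹) (scaleVars_comp ω (mul_inv_cancel₀ ha))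
    (scaleVars_comp ω (inv_mul_cancel₀ ha))

variable {K : Type u} [Field K] {n m : ℕ} (ω : Fin n → ℕ) (F : Fin m → MvPolynomial (Fin n) K)

theorem scaleVars_homogenize {L : Type u} [Field L] [Algebra K L] (a : L)
    (f : MvPolynomial (Fin n) K) :
    scaleVars ω a (MvPolynomial.map (Polynomial.aeval (R := K) a).toRingHom (homogenize ω f)) =
      C (a ^ weightedTotalDegree ω f) * MvPolynomial.map (algebraMap K L) f := by
  ext1 γ
  rw [coeff_scaleVars, coeff_map, coeff_homogenize, coeff_C_mul, coeff_map]
  by_cases h : coeff γ f = 0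
  · simp [h]
  · have h1 := le_weightedTotalDegree ω (mem_support_iff.2 h)
    change Polynomial.aeval a _ * _ = _
    rw [map_mul, map_pow, Polynomial.aeval_C, Polynomial.aeval_X, mul_assoc, ← pow_add,
      Nat.sub_add_cancel h1, mul_comm]

/-- The automorphism x_k ↦ a^(ω_k) x_k sends the equations of the fibre to those of `F` over `L`,
times powers of the unit `a`. -/
theorem nonempty_fiberAt_iso_of_ne_zero {L : Type u} [Field L] [Algebra K L] {a : L} (ha : a ≠ 0) :
    Nonempty (fiberAt (idealOf (homTuple ω F)) L a ≅
      specOver ((idealOf F).map (MvPolynomial.map (algebraMap K L)))) := by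
  obtain ⟨e₁⟩ := nonempty_pullback_iso_specOver (Polynomial.aeval (R := K) a).toRingHom
    (idealOf (homTuple ω F))
  obtain ⟨e₂⟩ := nonempty_specOver_iso (scaleEquiv ω ha)
    (I := (idealOf (homTuple ω F)).map (MvPolynomial.map (Polynomial.aeval (R := K) a).toRingHom))
    (J := (idealOf F).map (MvPolynomial.map (algebraMap K L))) (by
      rw [map_idealOf, map_idealOf, map_idealOf]
      apply idealOf_eq_of_associated
      intro i
      have hu : IsUnit (C (a ^ weightedTotalDegree ω (F i)) : MvPolynomial (Fin n) L) :=
        (pow_ne_zero _ ha).isUnit.map C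
      exact ((associated_isUnit_mul_right_iff hu).2
        (Associated.refl _)).trans (Associated.of_eq (scaleVars_homogenize ω a (F i)).symm))
  exact ⟨e₁ ≪≫ e₂⟩

variable {F} in
theorem nonempty_fiberAt_zero_iso {ord : MonomialOrder.{0, v} (Fin n)} (hF : ∀ i, F i ≠ 0)
    (hω : IsWeightLeading ord F ω) :
    Nonempty (fiberAt (idealOf (homTuple ω F)) K 0 ≅ specOver (idealOf (leadTuple ord F))) := by
  obtain ⟨e⟩ := nonempty_pullback_iso_specOver (Polynomial.aeval (R := K) (0 : K)).toRingHom
    (idealOf (homTuple ω F))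
  have h0 : (Polynomial.aeval (R := K) (0 : K)).toRingHom = Polynomial.constantCoeff :=
    RingHom.ext fun p => (Polynomial.coeff_zero_eq_aeval_zero p).symm
  have h : (idealOf (homTuple ω F)).map
      (MvPolynomial.map (Polynomial.aeval (R := K) (0 : K)).toRingHom) =
      idealOf (leadTuple ord F) := by
    rw [h0, map_idealOf]
    apply idealOf_eq_of_associated
    intro i
    have hu : IsUnit (C (ord.leadingCoeff (F i)) : MvPolynomial (Fin n) K) :=
      (ord.leadingCoeff_ne_zero_iff.2 (hF i)).isUnit.map C
    rw [map_constantCoeff_homTuple hF hω, initTuple, leadTuple,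
      ← mul_one (ord.leadingCoeff (F i)), ← C_mul_monomial]
    exact associated_unit_mul_left _ _ hu
  rw [h] at e
  exact ⟨e⟩

theorem nonempty_baseChangeSpec_iso (I : Ideal (MvPolynomial (Fin n) K)) (L : Type u) [Field L]
    [Algebra K L] :
    Nonempty (baseChangeSpec I L ≅ specOver (I.map (MvPolynomial.map (algebraMap K L)))) :=
  nonempty_pullback_iso_specOver (algebraMap K L) I

end Fibres

end

end GroebnerObstruction

/-! ### Assembly of the theorem -/

theorem mainTheorem3 {K : Type u} [Field K] {n m : ℕ} (ord : MonomialOrder.{0, v} (Fin n))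
    (F : Fin m → MvPolynomial (Fin n) K) (hF : ∀ i, F i ≠ 0) :
    -- for every weight that is compatible with the monomials of `F`
    (∀ ω : Fin n → ℕ, IsCompatible ord ω (monomialsOf F) →
      -- the fibres over `t ≠ 0` and over `t = 0`
      (∀ (L : Type u) [Field L] [Algebra K L] (a : L), a ≠ 0 →
        Nonempty (fiberAt (idealOf (homTuple ω F)) L a ≅ baseChangeSpec (idealOf F) L)) ∧
      (∀ a : K, a ≠ 0 →
        Nonempty (fiberAt (idealOf (homTuple ω F)) K a ≅ specOver (idealOf F))) ∧
      Nonempty (fiberAt (idealOf (homTuple ω F)) K 0 ≅ specOver (idealOf (leadTuple ord F))) ∧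
      -- `φ` takes values in `Syz(LM F)` when `F` is monic
      ((∀ i, ord.Monic (F i)) → ∀ z, phi ω F z ∈ Syz (leadTuple ord F)) ∧
      LImS ord ω F ⊆ LSL ord F ∧
      -- the criterion
      (IsGroebner ord F ↔
        Flat (family (idealOf (homTuple ω F))) ∧ LS ord F = LImS ord ω F) ∧
      -- flatness is equivalent to `N(F) = 0`
      (Flat (family (idealOf (homTuple ω F))) ↔ Subsingleton (NPart ord ω F)) ∧
      -- the splitting, when `ω` is also compatible with a Gröbner basis of `Syz(F)`
      ∀ V : Finset (Fin m → MvPolynomial (Fin n) K), IsModuleGroebner ord F V (Syz F) →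
        IsCompatible ord ω (monomialsOf F ∪ shiftedMonomialsOf ord F V) →
        (Submodule.span (MvPolynomial (Fin n) K) (topTerms F ω '' (Syz F : Set _)) : Set _) =
            Set.range (phi ω F) ∧
        LS ord F ⊆ LImS ord ω F ∧
        (∃ e : ObstructionModule ord F ≃ₗ[MvPolynomial (Fin n) K]
            (MPart ord ω F × NPart ord ω F),
          (∀ (w : Fin m → MvPolynomial (Fin n) K) (hw : w ∈ monSpan K (LSL ord F))
            (hw' : w ∈ monSpan K (LImS ord ω F)),
            e (MonQuot.mk (LS ord F) w hw) = (MonQuot.mk (LS ord F) w hw', 0)) ∧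
          (∀ (w : Fin m → MvPolynomial (Fin n) K) (hw : w ∈ monSpan K (LSL ord F)),
            (e (MonQuot.mk (LS ord F) w hw)).2 = MonQuot.mk (LImS ord ω F) w hw)) ∧
        (IsGroebner ord F ↔ Subsingleton (MPart ord ω F) ∧ Subsingleton (NPart ord ω F))) ∧
    -- such `V` and `ω` exist
    (∃ V : Finset (Fin m → MvPolynomial (Fin n) K), IsModuleGroebner ord F V (Syz F)) ∧
    (∀ V : Finset (Fin m → MvPolynomial (Fin n) K), IsModuleGroebner ord F V (Syz F) →
      ∃ ω : Fin n → ℕ,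
        IsCompatible ord ω (monomialsOf F ∪ shiftedMonomialsOf ord F V)) := by
  refine ⟨fun ω hω => ?_, exists_isModuleGroebner ord F _,
    fun V _ => exists_isCompatible ord (finite_monomialsOf_union ord F V)⟩
  have hw : IsWeightLeading ord F ω := hω.isWeightLeading ord hF
  have hN : Subsingleton (NPart ord ω F) ↔ LSL ord F ⊆ LImS ord ω F :=
    subsingleton_monQuot_iff isMonomialClosed_LImS
  refine ⟨fun L _ _ a ha => ?_, fun a ha => ?_, nonempty_fiberAt_zero_iso ω hF hw,
    fun hmonic z => ?_, LImS_subset_LSL hF hw, isGroebner_iff_flat hF hw,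
    (flat_family_iff_LSL_subset hF hw).trans hN.symm, fun V hV hc => ?_⟩
  · obtain ⟨e₁⟩ := nonempty_fiberAt_iso_of_ne_zero ω F ha
    obtain ⟨e₂⟩ := nonempty_baseChangeSpec_iso (idealOf F) L
    exact ⟨e₁ ≪≫ e₂.symm⟩
  · obtain ⟨e⟩ := nonempty_fiberAt_iso_of_ne_zero ω F ha
    rw [Algebra.algebraMap_self, map_idealOf] at e
    simp only [MvPolynomial.map_id] at e
    exact ⟨e⟩
  · have h : initTuple ord F = leadTuple ord F := by
      ext1 i
      rw [initTuple, leadTuple, (hmonic i).leadingCoeff_eq_one]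
    rw [← h]
    exact imPhi_le hF hw ⟨z, rfl⟩
  · have hc' : IsCompatible ord ω (shiftedMonomialsOf ord F V) := hc.mono Set.subset_union_right
    have h1 := LS_subset_LImS hF hw hV hc'
    have h2 := LImS_subset_LS hF hw hV hc'
    -- The two inclusions give LM(im φ) = LM(Syz(F)), so the kernel term M(F) of the sequence is
    -- zero.
    refine ⟨by rw [span_topTerms, coe_imPhi], h1, exists_splitting (h2.antisymm h1), ?_⟩
    have hM : Subsingleton (MPart ord ω F) ↔ LImS ord ω F ⊆ LS ord F :=
      subsingleton_monQuot_iff (isMonomialClosed_LMset ord F (Syz F))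
    rw [hM, hN, isGroebner_iff_LSL_subset hF hw]
    exact ⟨fun h => ⟨h2, h.trans h1⟩, fun h => h.2.trans h.1⟩
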